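/- **Theorem (deterministic equivalent).** Let $K\in\mathbb N$ be fixed, and let $p=p(n)$ be positive integers with $c_n:=p/n\to c\in(0,\infty)$ as $n\to\infty$. For each $n$ and $r\in\{1,\dots,K\}$ let $A_n^{(r)}\in\mathbb C^{p\times p}$ and $B_n^{(r)}\in\mathbb C^{n\times n}$ be deterministic positive semidefinite matrices, with every $B_n^{(r)}$ diagonal, and let $Z_n^{(r)}=(z_{ij}^{(r)})$ be random $p\times n$ complex matrices, all defined on one probability space. Assume: - (A1) there is $\tau>0$ such that $\|A_n^{(r)}\|_{op}\le\tau$ and $\|B_n^{(r)}\|_{op}\le\tau$ for all $n$ and $r$; - (A2) for each $n$ the entries $z_{ij}^{(r)}$ ($r\le K$, $i\le p$, $j\le n$) of $Z_n^{(1)},\dots,Z_n^{(K)}$ are independent, with $\mathbb E z_{ij}^{(r)}=0$, $\mathbb E|z_{ij}^{(r)}|^2=1$, and $|z_{ij}^{(r)}|\le n^a$ almost surely, where $\frac1{4+\eta_0}<a<\frac14$ for some $\eta_0>0$ (with $a$, $\eta_0$ not depending on $n,r,i,j$). Put $X_n=\sum_{r=1}^K (A_n^{(r)})^{1/2}Z_n^{(r)}(B_n^{(r)})^{1/2}$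 and $S_n=\frac1n X_nX_n^*$ and, for $z\in\mathbb C$ with $\Im z>0$, $$Q(z)=(S_n-zI_p)^{-1},\qquad h_{rn}(z)=\tfrac1p\operatorname{tr}\{A_n^{(r)}Q(z)\},$$ $$\bar Q(z)=\Big(-zI_p+\sum_{r=1}^K\Big(\tfrac1n\operatorname{tr}\Big\{B_n^{(r)}\Big[I_n+c_n\sum_{s=1}^K\mathbb E h_{sn}(z)\,B_n^{(s)}\Big]^{-1}\Big\}\Big)A_n^{(r)}\Big)^{-1}.$$ Then for every $z$ with $\Im z>0$ all these inverses and expectations exist, and $\bar Q(z)$ is a deterministic equivalent of $Q(z)$: for every sequence of deterministic matrices $M_n\in\mathbb C^{p\times p}$ with $\sup_n\|M_n\|_{op}<\infty$, $$\tfrac1p\operatorname{tr}\{(Q(z)-\bar Q(z))M_n\}\longrightarrow 0\quad\text{almost surely as }n\to\infty.$$ -/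

import Mathlib

open MeasureTheory ProbabilityTheory Filter Topology
open scoped ComplexOrder MatrixOrder Matrix.Norms.L2Operator

noncomputable section

namespace SumSeparable

variable {Ω : Type*} [MeasurableSpace Ω] {K p n : ℕ}

/-- The data matrix `X = ∑ᵣ Aᵣ^{1/2} Zᵣ Bᵣ^{1/2}`, with positive semidefinite square roots. -/
def dataMatrix (A : Fin K → Matrix (Fin p) (Fin p) ℂ) (B : Fin K → Matrix (Fin n) (Fin n) ℂ)
    (Z : Fin K → Matrix (Fin p) (Fin n) ℂ) : Matrix (Fin p) (Fin n) ℂ :=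
  ∑ r, CFC.sqrt (A r) * Z r * CFC.sqrt (B r)

/-- The sample covariance matrix `S = (1/n) X X*`. -/
def sampleCov (A : Fin K → Matrix (Fin p) (Fin p) ℂ) (B : Fin K → Matrix (Fin n) (Fin n) ℂ)
    (Z : Fin K → Matrix (Fin p) (Fin n) ℂ) : Matrix (Fin p) (Fin p) ℂ :=
  (1 / (n : ℂ)) • (dataMatrix A B Z * (dataMatrix A B Z).conjTranspose)

/-- The resolvent `Q(z) = (S - z I)⁻¹`. -/
def resolvent (A : Fin K → Matrix (Fin p) (Fin p) ℂ) (B : Fin K → Matrix (Fin n) (Fin n) ℂ)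
    (Z : Fin K → Matrix (Fin p) (Fin n) ℂ) (z : ℂ) : Matrix (Fin p) (Fin p) ℂ :=
  (sampleCov A B Z - z • (1 : Matrix (Fin p) (Fin p) ℂ))⁻¹

/-- `h_r(z) = (1/p) tr (A_r Q(z))`. -/
def hStat (A : Fin K → Matrix (Fin p) (Fin p) ℂ) (B : Fin K → Matrix (Fin n) (Fin n) ℂ)
    (Z : Fin K → Matrix (Fin p) (Fin n) ℂ) (z : ℂ) (r : Fin K) : ℂ :=
  (1 / (p : ℂ)) * (A r * resolvent A B Z z).trace

/-- The `n × n` matrix `I + c ∑ₛ E[h_s(z)] B_s`, with `c = p / n`. -/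
def innerMatrix (μ : Measure Ω) (A : Fin K → Matrix (Fin p) (Fin p) ℂ)
    (B : Fin K → Matrix (Fin n) (Fin n) ℂ) (Z : Fin K → Ω → Matrix (Fin p) (Fin n) ℂ) (z : ℂ) :
    Matrix (Fin n) (Fin n) ℂ :=
  1 + ((p : ℂ) / (n : ℂ)) • ∑ s, (∫ ω, hStat A B (fun r => Z r ω) z s ∂μ) • B s

/-- The `p × p` matrix `-z I + ∑ᵣ (1/n) tr (B_r [I + c ∑ₛ E[h_s(z)] B_s]⁻¹) A_r`. -/
def outerMatrix (μ : Measure Ω) (A : Fin K → Matrix (Fin p) (Fin p) ℂ)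
    (B : Fin K → Matrix (Fin n) (Fin n) ℂ) (Z : Fin K → Ω → Matrix (Fin p) (Fin n) ℂ) (z : ℂ) :
    Matrix (Fin p) (Fin p) ℂ :=
  -(z • (1 : Matrix (Fin p) (Fin p) ℂ)) +
    ∑ r, ((1 / (n : ℂ)) * (B r * (innerMatrix μ A B Z z)⁻¹).trace) • A r

/-- The deterministic matrix `Q̄(z)`, the inverse of `outerMatrix`. -/
def Qbar (μ : Measure Ω) (A : Fin K → Matrix (Fin p) (Fin p) ℂ)
    (B : Fin K → Matrix (Fin n) (Fin n) ℂ) (Z : Fin K → Ω → Matrix (Fin p) (Fin n) ℂ) (z : ℂ) :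
    Matrix (Fin p) (Fin p) ℂ :=
  (outerMatrix μ A B Z z)⁻¹

/-- A sequence of deterministic matrices `D n` is a deterministic equivalent of a sequence of
random matrices `R n`: for every sequence of deterministic matrices `M n` with uniformly bounded
operator norm, `(1/p) tr ((R n - D n) M n) → 0` almost surely. -/
def IsDeterministicEquivalent (μ : Measure Ω) {p : ℕ → ℕ}
    (R : (n : ℕ) → Ω → Matrix (Fin (p n)) (Fin (p n)) ℂ)
    (D : (n : ℕ) → Matrix (Fin (p n)) (Fin (p n)) ℂ) : Prop :=
  ∀ M : (n : ℕ) → Matrix (Fin (p n)) (Fin (p n)) ℂ, (∃ C : ℝ, ∀ n, ‖M n‖ ≤ C) →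
    ∀ᵐ ω ∂μ, Tendsto (fun n => (1 / (p n : ℂ)) * ((R n ω - D n) * M n).trace) atTop (𝓝 0)

end SumSeparable

end

/-!
Since the `Bᵣ` are diagonal, the columns `xⱼ` of the data matrix are independent and
`S = (1/n) ∑ⱼ xⱼ xⱼ*`. The Sherman–Morrison formula expresses `Q xⱼ` through the resolvent with
column `j` left out, so that `tr (Q M) - tr (Q̄ M)` becomes an average over `j` of differences
between a quadratic form in `xⱼ` and the trace it is centred at. Given the other columns, a
quadratic form in `xⱼ` has standard deviation `O(√(κ n))`, where `κ` bounds the fourth moments of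
the entries; this makes `E tr (Q M) - tr (Q̄ M)` of order `o(n)` as soon as `κ = o(n)`. On the other
hand, replacing one column moves `tr (Q M)` by `O(1)`, so its fourth central moment is `O(n²)`. As
`p ≍ n`, the fourth moments of the normalised fluctuations are `O(n⁻²)`, hence summable.
-/

noncomputable section

open Asymptotics
open scoped Matrix RealInnerProductSpace

namespace SumSeparable

theorem integrable_inner {α V : Type*} [MeasurableSpace α] {P : Measure α} [NormedAddCommGroup V]
    [InnerProductSpace ℝ V] {f g : α → V} (hf : MemLp f 2 P) (hg : MemLp g 2 P) :
    Integrable (fun x => ⟪f x, g x⟫) P :=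
  (hf.norm.integrable_mul hg.norm).mono' (hf.aestronglyMeasurable.inner hg.aestronglyMeasurable)
    (Eventually.of_forall fun _ => norm_inner_le_norm _ _)

theorem memLp_two_norm_sq {α V : Type*} [MeasurableSpace α] {P : Measure α} [NormedAddCommGroup V]
    {f : α → V} (hf : MemLp f 4 P) : MemLp (fun x => ‖f x‖ ^ 2) 2 P := by
  refine (memLp_two_iff_integrable_sq (hf.aestronglyMeasurable.norm.pow 2)).2 ?_
  simp only [Pi.pow_apply, ← pow_mul]
  exact hf.integrable_norm_pow (p := 4) four_ne_zero

section EfronStein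

variable {ι : Type*} [DecidableEq ι] {E : ι → Type*} [∀ i, MeasurableSpace (E i)]
  {ρ : (i : ι) → Measure (E i)}

/-- The function `f` averaged over its `i`-th coordinate: the conditional expectation of `f` given
all coordinates but the `i`-th, under the product of the laws `ρ`. -/
def avg {V : Type*} [NormedAddCommGroup V] [NormedSpace ℝ V] (ρ : (i : ι) → Measure (E i)) (i : ι)
    (f : ((j : ι) → E j) → V) (x : (j : ι) → E j) : V :=
  ∫ y, f (Function.update x i y) ∂ρ i

section avg

variable {V : Type*} [NormedAddCommGroup V] [NormedSpace ℝ V] {f : ((j : ι) → E j) → V}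

theorem avg_update_self (i : ι) (x : (j : ι) → E j) (y : E i) :
    avg ρ i f (Function.update x i y) = avg ρ i f x := by
  simp only [avg, Function.update_idem]

theorem avg_update_of_ne {i j : ι} (hij : i ≠ j) (h : ∀ x y, f (Function.update x j y) = f x)
    (x : (j : ι) → E j) (y : E j) : avg ρ i f (Function.update x j y) = avg ρ i f x := by
  simp only [avg, Function.update_comm hij.symm, h]

end avg

omit [∀ i, MeasurableSpace (E i)] in
theorem eq_of_forall_update_eq [Finite ι] {V : Type*} {g : ((i : ι) → E i) → V}
    (h : ∀ i x y, g (Function.update x i y) = g x) (x w : (i : ι) → E i) : g x = g w := by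
  have := Fintype.ofFinite ι
  have hpiecewise (s : Finset ι) : g (s.piecewise x w) = g w := by
    induction s using Finset.induction_on with
    | empty => rw [Finset.piecewise_empty]
    | insert a s _ ih => rw [Finset.piecewise_insert, h, ih]
  simpa only [Finset.piecewise_univ] using hpiecewise Finset.univ

variable [Fintype ι] [∀ i, IsProbabilityMeasure (ρ i)]

theorem measurePreserving_update (i : ι) :
    MeasurePreserving (fun q : ((j : ι) → E j) × E i => Function.update q.1 i q.2)
      ((Measure.pi ρ).prod (ρ i)) (Measure.pi ρ) := by
  refine ⟨measurable_update', Measure.ext fun s hs => ?_⟩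
  have hind : Measurable (s.indicator (1 : ((j : ι) → E j) → ENNReal)) :=
    measurable_one.indicator hs
  have hindT : Measurable fun q : ((j : ι) → E j) × E i =>
      s.indicator (1 : ((j : ι) → E j) → ENNReal) (Function.update q.1 i q.2) :=
    hind.comp measurable_update'
  rw [← lintegral_indicator_one hs, ← lintegral_indicator_one hs,
    lintegral_map hind measurable_update', lintegral_prod _ hindT.aemeasurable]
  refine lintegral_eq_of_lmarginal_eq {i} hindT.lintegral_prod_right' hind ?_
  simp [lmarginal_singleton]

theorem ae_integrable_update {V : Type*} [NormedAddCommGroup V] {f : ((j : ι) → E j) → V}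
    (hf : Integrable f (Measure.pi ρ)) (i : ι) :
    ∀ᵐ x ∂Measure.pi ρ, Integrable (fun y => f (Function.update x i y)) (ρ i) :=
  ((measurePreserving_update i).integrable_comp_of_integrable hf).prod_right_ae

section NormedSpace

variable {V : Type*} [NormedAddCommGroup V] [NormedSpace ℝ V] {f g : ((j : ι) → E j) → V}

theorem integrable_avg (hf : Integrable f (Measure.pi ρ)) (i : ι) :
    Integrable (avg ρ i f) (Measure.pi ρ) :=
  ((measurePreserving_update i).integrable_comp_of_integrable hf).integral_prod_left

theorem integral_avg (hf : Integrable f (Measure.pi ρ)) (i : ι) :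
    ∫ x, avg ρ i f x ∂Measure.pi ρ = ∫ x, f x ∂Measure.pi ρ := by
  have hT := measurePreserving_update (ρ := ρ) i
  have hfT := hT.integrable_comp_of_integrable hf
  calc ∫ x, avg ρ i f x ∂Measure.pi ρ
      = ∫ q, f (Function.update q.1 i q.2) ∂(Measure.pi ρ).prod (ρ i) := (integral_prod _ hfT).symm
    _ = ∫ x, f x ∂Measure.pi ρ := by
      rw [← hT.map_eq] at hf
      conv_rhs => rw [← hT.map_eq]
      exact (integral_map hT.aemeasurable hf.aestronglyMeasurable).symm

theorem avg_sub_ae_eq (hf : Integrable f (Measure.pi ρ)) (hg : Integrable g (Measure.pi ρ))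
    (i : ι) : avg ρ i (f - g) =ᵐ[Measure.pi ρ] avg ρ i f - avg ρ i g := by
  filter_upwards [ae_integrable_update hf i, ae_integrable_update hg i] with x hfx hgx
  exact integral_sub hfx hgx

variable [CompleteSpace V]

theorem norm_avg_sq_le_ae (hf : MemLp f 2 (Measure.pi ρ)) (i : ι) :
    ∀ᵐ x ∂Measure.pi ρ, ‖avg ρ i f x‖ ^ 2 ≤ avg ρ i (fun y => ‖f y‖ ^ 2) x := by
  filter_upwards [ae_integrable_update (hf.integrable one_le_two) i,
    ae_integrable_update (hf.integrable_norm_pow two_ne_zero) i] with x hx hx2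
  exact (convexOn_univ_norm.pow (fun _ _ => norm_nonneg _) 2).map_integral_le
    (by fun_prop) isClosed_univ (by simp) hx hx2

theorem memLp_avg (hf : MemLp f 2 (Measure.pi ρ)) (i : ι) : MemLp (avg ρ i f) 2 (Measure.pi ρ) := by
  have hmeas := (integrable_avg (hf.integrable one_le_two) i).aestronglyMeasurable
  rw [memLp_two_iff_integrable_sq_norm hmeas]
  refine (integrable_avg (hf.integrable_norm_pow two_ne_zero) i).mono' (hmeas.norm.pow 2) ?_
  simpa only [norm_pow, norm_norm] using norm_avg_sq_le_ae hf i

theorem integral_norm_avg_sq_le (hf : MemLp f 2 (Measure.pi ρ)) (i : ι) :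
    ∫ x, ‖avg ρ i f x‖ ^ 2 ∂Measure.pi ρ ≤ ∫ x, ‖f x‖ ^ 2 ∂Measure.pi ρ := by
  have hf2 := hf.integrable_norm_pow two_ne_zero
  rw [← integral_avg hf2 i]
  exact integral_mono_ae ((memLp_avg hf i).integrable_norm_pow two_ne_zero) (integrable_avg hf2 i)
    (norm_avg_sq_le_ae hf i)

end NormedSpace

section InnerProductSpace

variable {V : Type*} [NormedAddCommGroup V] [InnerProductSpace ℝ V] [CompleteSpace V]
  {f g : ((j : ι) → E j) → V}

theorem integral_inner_sub_avg_eq_zero (hf : MemLp f 2 (Measure.pi ρ))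
    (hg : MemLp g 2 (Measure.pi ρ)) {i : ι} (h : ∀ x y, g (Function.update x i y) = g x) :
    ∫ x, ⟪g x, f x - avg ρ i f x⟫ ∂Measure.pi ρ = 0 := by
  have hgf := integrable_inner hg hf
  have havg : avg ρ i (fun x => ⟪g x, f x⟫) =ᵐ[Measure.pi ρ] fun x => ⟪g x, avg ρ i f x⟫ := by
    filter_upwards [ae_integrable_update (hf.integrable one_le_two) i] with x hx
    simp only [avg, h]
    exact integral_inner hx (g x)
  simp only [inner_sub_right]
  rw [integral_sub hgf (integrable_inner hg (memLp_avg hf i)), ← integral_congr_ae havg,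
    integral_avg hgf, sub_self]

/-- Pythagoras' theorem: averaging is an orthogonal projection of `L²`. -/
theorem integral_norm_sub_sq_eq_add_avg (hf : MemLp f 2 (Measure.pi ρ))
    (hg : MemLp g 2 (Measure.pi ρ)) {i : ι} (h : ∀ x y, g (Function.update x i y) = g x) :
    ∫ x, ‖f x - g x‖ ^ 2 ∂Measure.pi ρ =
      ∫ x, ‖f x - avg ρ i f x‖ ^ 2 ∂Measure.pi ρ +
        ∫ x, ‖avg ρ i f x - g x‖ ^ 2 ∂Measure.pi ρ := by
  have hfa := hf.sub (memLp_avg hf i)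
  have hag := (memLp_avg hf i).sub hg
  have hcross : ∫ x, ⟪(avg ρ i f - g) x, (f - avg ρ i f) x⟫ ∂Measure.pi ρ = 0 :=
    integral_inner_sub_avg_eq_zero hf hag fun x y => by
      rw [Pi.sub_apply, Pi.sub_apply, avg_update_self, h]
  have hexpand (x) : ‖f x - g x‖ ^ 2 = ‖(f - avg ρ i f) x‖ ^ 2 + ‖(avg ρ i f - g) x‖ ^ 2 +
      2 * ⟪(avg ρ i f - g) x, (f - avg ρ i f) x⟫ := by
    rw [real_inner_comm, add_right_comm, ← norm_add_sq_real, Pi.sub_apply, Pi.sub_apply,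
      sub_add_sub_cancel]
  have hfa2 := hfa.integrable_norm_pow two_ne_zero
  have hag2 := hag.integrable_norm_pow two_ne_zero
  simp only [hexpand]
  refine (integral_add (hfa2.add hag2) ((integrable_inner hag hfa).const_mul 2)).trans ?_
  rw [integral_const_mul, hcross, mul_zero, add_zero]
  exact integral_add hfa2 hag2

theorem integral_norm_sub_avg_sq_le (hf : MemLp f 2 (Measure.pi ρ))
    (hg : MemLp g 2 (Measure.pi ρ)) {i : ι} (h : ∀ x y, g (Function.update x i y) = g x) :
    ∫ x, ‖f x - avg ρ i f x‖ ^ 2 ∂Measure.pi ρ ≤ ∫ x, ‖f x - g x‖ ^ 2 ∂Measure.pi ρ := by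
  rw [integral_norm_sub_sq_eq_add_avg hf hg h]
  exact le_add_of_nonneg_right (integral_nonneg fun x => by positivity)

theorem exists_partial_average (hf : MemLp f 2 (Measure.pi ρ)) (s : Finset ι) :
    ∃ g : ((i : ι) → E i) → V, MemLp g 2 (Measure.pi ρ) ∧
      (∀ i ∈ s, ∀ x y, g (Function.update x i y) = g x) ∧
      ∫ x, g x ∂Measure.pi ρ = ∫ x, f x ∂Measure.pi ρ ∧
      ∫ x, ‖f x - g x‖ ^ 2 ∂Measure.pi ρ ≤
        ∑ i ∈ s, ∫ x, ‖f x - avg ρ i f x‖ ^ 2 ∂Measure.pi ρ := by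
  induction s using Finset.induction_on with
  | empty => exact ⟨f, hf, by simp, rfl, by simp⟩
  | insert a s ha ih =>
    obtain ⟨g, hg, hgs, hgint, hle⟩ := ih
    refine ⟨avg ρ a g, memLp_avg hg a, fun i hi => ?_,
      (integral_avg (hg.integrable one_le_two) a).trans hgint, ?_⟩
    · obtain rfl | hia := eq_or_ne i a
      · exact avg_update_self i
      · exact avg_update_of_ne hia.symm (hgs i (Finset.mem_of_mem_insert_of_ne hi hia))
    · rw [Finset.sum_insert ha,
        integral_norm_sub_sq_eq_add_avg hf (memLp_avg hg a) (avg_update_self a)]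
      gcongr
      refine le_trans (le_of_eq ?_) ((integral_norm_avg_sq_le (hf.sub hg) a).trans hle)
      refine integral_congr_ae ?_
      filter_upwards [avg_sub_ae_eq (hf.integrable one_le_two) (hg.integrable one_le_two) a]
        with x hx
      rw [hx, Pi.sub_apply]

theorem efron_stein (hf : MemLp f 2 (Measure.pi ρ)) {h : ι → ((i : ι) → E i) → V}
    (hh : ∀ i, MemLp (h i) 2 (Measure.pi ρ)) (hi : ∀ i x y, h i (Function.update x i y) = h i x) :
    ∫ x, ‖f x - ∫ w, f w ∂Measure.pi ρ‖ ^ 2 ∂Measure.pi ρ ≤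
      ∑ i, ∫ x, ‖f x - h i x‖ ^ 2 ∂Measure.pi ρ := by
  obtain ⟨g, -, hg, hgint, hle⟩ := exists_partial_average hf Finset.univ
  have hconst (x) : g x = ∫ w, f w ∂Measure.pi ρ := by
    rw [← hgint, integral_congr_ae (Eventually.of_forall fun w =>
      eq_of_forall_update_eq (fun i => hg i (Finset.mem_univ i)) w x), integral_const,
      probReal_univ, one_smul]
  simp only [hconst] at hle
  exact hle.trans (Finset.sum_le_sum fun i _ => integral_norm_sub_avg_sq_le hf (hh i) (hi i))

section BoundedDifferences

variable {h : ι → ((i : ι) → E i) → V} {κ : ℝ}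

theorem variance_le_of_bounded_differences (hf : MemLp f 2 (Measure.pi ρ))
    (hh : ∀ i, MemLp (h i) 2 (Measure.pi ρ)) (hi : ∀ i x y, h i (Function.update x i y) = h i x)
    (hκ : ∀ i x, ‖f x - h i x‖ ≤ κ) :
    ∫ x, ‖f x - ∫ w, f w ∂Measure.pi ρ‖ ^ 2 ∂Measure.pi ρ ≤ Fintype.card ι * κ ^ 2 := by
  have hterm (i : ι) : ∫ x, ‖f x - h i x‖ ^ 2 ∂Measure.pi ρ ≤ κ ^ 2 := by
    refine (integral_mono ((hf.sub (hh i)).integrable_norm_pow two_ne_zero)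
      (integrable_const (κ ^ 2)) fun x => pow_le_pow_left₀ (norm_nonneg _) (hκ i x) 2).trans ?_
    simp
  exact (efron_stein hf hh hi).trans
    ((Finset.sum_le_card_nsmul _ _ _ fun i _ => hterm i).trans_eq (by simp))

theorem sq_sub_sq_sq_le {a b : ℝ} (ha : 0 ≤ a) (hb : 0 ≤ b) (hab : |a - b| ≤ κ) :
    (a ^ 2 - b ^ 2) ^ 2 ≤ 8 * κ ^ 2 * a ^ 2 + 2 * κ ^ 4 := by
  obtain ⟨hab₁, hab₂⟩ := abs_le.1 hab
  calc (a ^ 2 - b ^ 2) ^ 2 = (a - b) ^ 2 * (a + b) ^ 2 := by ring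
    _ ≤ κ ^ 2 * (2 * a + κ) ^ 2 := by
      refine mul_le_mul (sq_le_sq' hab₁ hab₂) ?_ (sq_nonneg _) (sq_nonneg κ)
      exact pow_le_pow_left₀ (by positivity) (by linarith) 2
    _ ≤ κ ^ 2 * (8 * a ^ 2 + 2 * κ ^ 2) := by
      gcongr
      linarith [sq_nonneg (2 * a - κ)]
    _ = 8 * κ ^ 2 * a ^ 2 + 2 * κ ^ 4 := by ring

theorem integral_sq_eq_integral_sub_sq_add {α : Type*} [MeasurableSpace α] {P : Measure α}
    [IsProbabilityMeasure P] {u : α → ℝ} (hu : MemLp u 2 P) :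
    ∫ x, u x ^ 2 ∂P = ∫ x, (u x - ∫ w, u w ∂P) ^ 2 ∂P + (∫ w, u w ∂P) ^ 2 := by
  have h := variance_eq_sub hu
  rw [variance_eq_integral hu.aemeasurable] at h
  simp only [Pi.pow_apply] at h
  linarith

theorem variance_norm_sub_sq_le_of_bounded_differences {W : Type*} [NormedAddCommGroup W]
    {f : ((i : ι) → E i) → W} {h : ι → ((i : ι) → E i) → W} (hf : MemLp f 4 (Measure.pi ρ))
    (hh : ∀ i, MemLp (h i) 4 (Measure.pi ρ)) (hi : ∀ i x y, h i (Function.update x i y) = h i x)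
    (hκ : ∀ i x, ‖f x - h i x‖ ≤ κ) (m : W) :
    ∫ x, (‖f x - m‖ ^ 2 - ∫ w, ‖f w - m‖ ^ 2 ∂Measure.pi ρ) ^ 2 ∂Measure.pi ρ ≤
      Fintype.card ι * (8 * κ ^ 2 * ∫ x, ‖f x - m‖ ^ 2 ∂Measure.pi ρ + 2 * κ ^ 4) := by
  have hu : MemLp (fun x => ‖f x - m‖ ^ 2) 2 (Measure.pi ρ) :=
    memLp_two_norm_sq (hf.sub (memLp_const m))
  have hv (i) : MemLp (fun x => ‖h i x - m‖ ^ 2) 2 (Measure.pi ρ) :=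
    memLp_two_norm_sq ((hh i).sub (memLp_const m))
  have hpt (i x) : (‖f x - m‖ ^ 2 - ‖h i x - m‖ ^ 2) ^ 2 ≤
      8 * κ ^ 2 * ‖f x - m‖ ^ 2 + 2 * κ ^ 4 :=
    sq_sub_sq_sq_le (norm_nonneg _) (norm_nonneg _)
      ((abs_norm_sub_norm_le _ _).trans (by simpa using hκ i x))
  have hterm (i : ι) : ∫ x, (‖f x - m‖ ^ 2 - ‖h i x - m‖ ^ 2) ^ 2 ∂Measure.pi ρ ≤
      8 * κ ^ 2 * ∫ x, ‖f x - m‖ ^ 2 ∂Measure.pi ρ + 2 * κ ^ 4 := by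
    have hu1 := (hu.integrable one_le_two).const_mul (8 * κ ^ 2)
    refine (integral_mono (hu.sub (hv i)).integrable_sq (hu1.add (integrable_const _))
      (hpt i)).trans_eq ((integral_add hu1 (integrable_const _)).trans ?_)
    rw [integral_const_mul, integral_const, probReal_univ, one_smul]
  have hES := efron_stein hu hv fun i x y => by rw [hi]
  simp only [Real.norm_eq_abs, sq_abs] at hES
  exact hES.trans ((Finset.sum_le_card_nsmul _ _ _ fun i _ => hterm i).trans_eq
    (nsmul_eq_mul _ _))

theorem fourth_moment_le_of_bounded_differences (hf : MemLp f 4 (Measure.pi ρ))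
    (hh : ∀ i, MemLp (h i) 4 (Measure.pi ρ)) (hi : ∀ i x y, h i (Function.update x i y) = h i x)
    (hκ : ∀ i x, ‖f x - h i x‖ ≤ κ) :
    ∫ x, ‖f x - ∫ w, f w ∂Measure.pi ρ‖ ^ 4 ∂Measure.pi ρ ≤
      11 * (Fintype.card ι : ℝ) ^ 2 * κ ^ 4 := by
  have h24 : (2 : ENNReal) ≤ 4 := by norm_num
  have hvar := variance_le_of_bounded_differences (hf.mono_exponent h24)
    (fun i => (hh i).mono_exponent h24) hi hκ
  set m := ∫ w, f w ∂Measure.pi ρ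
  set N : ℝ := (Fintype.card ι : ℝ)
  set e := ∫ x, ‖f x - m‖ ^ 2 ∂Measure.pi ρ
  have hN : N ≤ N ^ 2 := by
    simp only [N]
    exact_mod_cast Nat.le_self_pow two_ne_zero (Fintype.card ι)
  have : 0 ≤ e := integral_nonneg fun x => sq_nonneg _
  calc ∫ x, ‖f x - m‖ ^ 4 ∂Measure.pi ρ = ∫ x, (‖f x - m‖ ^ 2 - e) ^ 2 ∂Measure.pi ρ + e ^ 2 := by
        refine Eq.trans ?_ (integral_sq_eq_integral_sub_sq_add
          (memLp_two_norm_sq (hf.sub (memLp_const m))))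
        simp only [← pow_mul, Nat.reduceMul]
    _ ≤ N * (8 * κ ^ 2 * (N * κ ^ 2) + 2 * κ ^ 4) + (N * κ ^ 2) ^ 2 := by
        refine add_le_add
          ((variance_norm_sub_sq_le_of_bounded_differences hf hh hi hκ m).trans ?_) ?_ <;> gcongr
    _ = 9 * N ^ 2 * κ ^ 4 + 2 * (N * κ ^ 4) := by ring
    _ ≤ 9 * N ^ 2 * κ ^ 4 + 2 * (N ^ 2 * κ ^ 4) := by gcongr
    _ = 11 * N ^ 2 * κ ^ 4 := by ring

end BoundedDifferences

end InnerProductSpace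

end EfronStein

section EuclideanNorm

variable {m k : Type*} [Fintype m] [Fintype k]

/-- The Euclidean norm of a complex vector, the norm on `m → ℂ` itself being the supremum norm. -/
def l2Norm (u : m → ℂ) : ℝ := ‖WithLp.toLp 2 u‖

theorem l2Norm_nonneg (u : m → ℂ) : 0 ≤ l2Norm u := norm_nonneg _

theorem l2Norm_sq (u : m → ℂ) : l2Norm u ^ 2 = ∑ i, ‖u i‖ ^ 2 :=
  EuclideanSpace.norm_sq_eq _

theorem l2Norm_eq_zero {u : m → ℂ} : l2Norm u = 0 ↔ u = 0 := by
  simp only [l2Norm, norm_eq_zero, WithLp.toLp_eq_zero]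

theorem l2Norm_smul (c : ℂ) (u : m → ℂ) : l2Norm (c • u) = ‖c‖ * l2Norm u := by
  rw [l2Norm, WithLp.toLp_smul, norm_smul, l2Norm]

theorem l2Norm_star (u : m → ℂ) : l2Norm (star u) = l2Norm u := by
  rw [← sq_eq_sq₀ (l2Norm_nonneg _) (l2Norm_nonneg _), l2Norm_sq, l2Norm_sq]
  simp only [Pi.star_apply, norm_star]

theorem l2Norm_single_one [DecidableEq m] (i : m) : l2Norm (Pi.single i (1 : ℂ)) = 1 := by
  rw [l2Norm, PiLp.toLp_single, PiLp.norm_single, norm_one]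

theorem star_dotProduct_self (u : m → ℂ) : star u ⬝ᵥ u = ((l2Norm u ^ 2 : ℝ) : ℂ) := by
  simp [l2Norm_sq, dotProduct, Complex.conj_mul']

theorem norm_dotProduct_le (u w : m → ℂ) : ‖u ⬝ᵥ w‖ ≤ l2Norm u * l2Norm w := by
  have h := norm_inner_le_norm (𝕜 := ℂ) (WithLp.toLp 2 (star u)) (WithLp.toLp 2 w)
  rwa [EuclideanSpace.inner_toLp_toLp, star_star, dotProduct_comm, ← l2Norm, ← l2Norm,
    l2Norm_star] at h

theorem l2Norm_mulVec_le [DecidableEq k] (T : Matrix m k ℂ) (u : k → ℂ) :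
    l2Norm (T.mulVec u) ≤ ‖T‖ * l2Norm u :=
  T.l2_opNorm_mulVec (WithLp.toLp 2 u)

theorem l2_opNorm_le_bound [DecidableEq k] {T : Matrix m k ℂ} {C : ℝ} (hC : 0 ≤ C)
    (h : ∀ u, l2Norm (T.mulVec u) ≤ C * l2Norm u) : ‖T‖ ≤ C := by
  rw [Matrix.l2_opNorm_def]
  exact ContinuousLinearMap.opNorm_le_bound _ hC fun x => h x.ofLp

theorem sum_norm_sq_col_le [DecidableEq k] (T : Matrix m k ℂ) (j : k) :
    ∑ i, ‖T i j‖ ^ 2 ≤ ‖T‖ ^ 2 := by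
  have h := l2Norm_mulVec_le T (Pi.single j 1)
  rw [l2Norm_single_one, mul_one, Matrix.mulVec_single_one] at h
  simpa only [l2Norm_sq, Matrix.col_apply] using pow_le_pow_left₀ (l2Norm_nonneg _) h 2

theorem sum_norm_sq_row_le [DecidableEq k] (T : Matrix m k ℂ) (i : m) :
    ∑ j, ‖T i j‖ ^ 2 ≤ ‖T‖ ^ 2 := by
  classical
  simpa only [Matrix.conjTranspose_apply, norm_star, Matrix.l2_opNorm_conjTranspose] using
    sum_norm_sq_col_le T.conjTranspose i

theorem norm_apply_le_l2_opNorm [DecidableEq k] (T : Matrix m k ℂ) (i : m) (j : k) :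
    ‖T i j‖ ≤ ‖T‖ :=
  (sq_le_sq₀ (norm_nonneg _) (norm_nonneg _)).1 <| (Finset.single_le_sum
    (f := fun i => ‖T i j‖ ^ 2) (fun _ _ => sq_nonneg _) (Finset.mem_univ i)).trans
      (sum_norm_sq_col_le T j)

theorem l2_opNorm_one_le [DecidableEq m] : ‖(1 : Matrix m m ℂ)‖ ≤ 1 := by
  rw [← Matrix.diagonal_one, Matrix.l2_opNorm_diagonal]
  exact (pi_norm_le_iff_of_nonneg zero_le_one).2 fun _ => norm_one.le

theorem norm_trace_le [DecidableEq m] (T : Matrix m m ℂ) : ‖T.trace‖ ≤ Fintype.card m * ‖T‖ := by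
  refine (norm_sum_le_of_le _ fun i _ => norm_apply_le_l2_opNorm T i i).trans_eq ?_
  rw [Finset.sum_const, Finset.card_univ, nsmul_eq_mul]

theorem l2_opNorm_mul_conjTranspose_self_le [DecidableEq m] [DecidableEq k] (G : Matrix m k ℂ) :
    ‖G * G.conjTranspose‖ ≤ ‖G‖ ^ 2 := by
  simpa only [Matrix.l2_opNorm_conjTranspose, ← sq] using Matrix.l2_opNorm_mul G G.conjTranspose

theorem l2Norm_mul_l2Norm_le [DecidableEq k] (a : m → ℂ) (b : k → ℂ) :
    l2Norm a * l2Norm b ≤ ‖Matrix.vecMulVec a b‖ := by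
  rcases (l2Norm_nonneg b).eq_or_lt with hb | hb
  · rw [← hb, mul_zero]
    exact norm_nonneg _
  have hmul : (Matrix.vecMulVec a b).mulVec (star b) = ((l2Norm b ^ 2 : ℝ) : ℂ) • a := by
    rw [Matrix.vecMulVec_mulVec, dotProduct_comm, star_dotProduct_self, op_smul_eq_smul]
  have h := l2Norm_mulVec_le (Matrix.vecMulVec a b) (star b)
  rw [hmul, l2Norm_smul, l2Norm_star, Complex.norm_real, Real.norm_of_nonneg (sq_nonneg _), sq,
    mul_assoc, mul_comm ‖_‖] at h
  linarith [le_of_mul_le_mul_left h hb]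

theorem norm_trace_vecMulVec_mul_le [DecidableEq m] (a b : m → ℂ) (M : Matrix m m ℂ) :
    ‖(Matrix.vecMulVec a b * M).trace‖ ≤ ‖Matrix.vecMulVec a b‖ * ‖M‖ := by
  rw [Matrix.trace_mul_comm, Matrix.mul_vecMulVec, Matrix.trace_vecMulVec]
  calc ‖M.mulVec a ⬝ᵥ b‖ ≤ ‖M‖ * l2Norm a * l2Norm b :=
        (norm_dotProduct_le _ _).trans <|
          mul_le_mul_of_nonneg_right (l2Norm_mulVec_le M a) (l2Norm_nonneg b)
    _ = l2Norm a * l2Norm b * ‖M‖ := by ring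
    _ ≤ ‖Matrix.vecMulVec a b‖ * ‖M‖ := by gcongr; exact l2Norm_mul_l2Norm_le a b

end EuclideanNorm

section ImaginaryPart

variable {m : Type*} [Fintype m] {H : Matrix m m ℂ} {v : ℝ}

theorem mul_l2Norm_le_of_im_quadForm_le
    (hH : ∀ u : m → ℂ, (star u ⬝ᵥ H.mulVec u).im ≤ -v * l2Norm u ^ 2) (u : m → ℂ) :
    v * l2Norm u ≤ l2Norm (H.mulVec u) := by
  rcases (l2Norm_nonneg u).eq_or_lt with hu | hu
  · rw [← hu, mul_zero]
    exact l2Norm_nonneg _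
  refine le_of_mul_le_mul_left ?_ hu
  calc l2Norm u * (v * l2Norm u) ≤ -(star u ⬝ᵥ H.mulVec u).im := by linarith [hH u]
    _ ≤ ‖star u ⬝ᵥ H.mulVec u‖ := (neg_le_abs _).trans (Complex.abs_im_le_norm _)
    _ ≤ l2Norm u * l2Norm (H.mulVec u) := by
        simpa only [l2Norm_star] using norm_dotProduct_le (star u) (H.mulVec u)

variable [DecidableEq m]

theorem isUnit_of_im_quadForm_le (hv : 0 < v)
    (hH : ∀ u : m → ℂ, (star u ⬝ᵥ H.mulVec u).im ≤ -v * l2Norm u ^ 2) : IsUnit H := by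
  refine Matrix.mulVec_injective_iff_isUnit.1 fun x y hxy => sub_eq_zero.1 (l2Norm_eq_zero.1 ?_)
  have h := mul_l2Norm_le_of_im_quadForm_le hH (x - y)
  rw [Matrix.mulVec_sub, sub_eq_zero.2 hxy, l2Norm_eq_zero.2 rfl] at h
  exact le_antisymm (nonpos_of_mul_nonpos_right h hv) (l2Norm_nonneg _)

theorem l2_opNorm_inv_le_of_im_quadForm_le (hv : 0 < v)
    (hH : ∀ u : m → ℂ, (star u ⬝ᵥ H.mulVec u).im ≤ -v * l2Norm u ^ 2) : ‖H⁻¹‖ ≤ 1 / v := by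
  refine l2_opNorm_le_bound (by positivity) fun u => ?_
  have h := mul_l2Norm_le_of_im_quadForm_le hH (H⁻¹.mulVec u)
  rw [Matrix.mulVec_mulVec, Matrix.mul_nonsing_inv _
    ((Matrix.isUnit_iff_isUnit_det _).1 (isUnit_of_im_quadForm_le hv hH)), Matrix.one_mulVec] at h
  rw [one_div_mul_eq_div, le_div_iff₀ hv, mul_comm]
  exact h

end ImaginaryPart

/-- `α` is a possible value at `z` of the Stieltjes transform of a positive finite measure on
`[0, ∞)`: both `α` and `z α` lie in the closed upper half plane. -/
structure IsStieltjesValue (z α : ℂ) : Prop where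
  im_nonneg : 0 ≤ α.im
  im_mul_nonneg : 0 ≤ (z * α).im

namespace IsStieltjesValue

variable {z α : ℂ}

theorem sum {ι : Type*} {s : Finset ι} {f : ι → ℂ} (hf : ∀ i ∈ s, IsStieltjesValue z (f i)) :
    IsStieltjesValue z (∑ i ∈ s, f i) where
  im_nonneg := by
    rw [Complex.im_sum]
    exact Finset.sum_nonneg fun i hi => (hf i hi).im_nonneg
  im_mul_nonneg := by
    rw [Finset.mul_sum, Complex.im_sum]
    exact Finset.sum_nonneg fun i hi => (hf i hi).im_mul_nonneg

theorem one_div_natCast_mul (hα : IsStieltjesValue z α) (n : ℕ) :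
    IsStieltjesValue z (1 / (n : ℂ) * α) := by
  have hn : (1 / (n : ℂ)) = ((n : ℝ)⁻¹ : ℝ) := by push_cast; exact one_div _
  rw [hn]
  constructor
  · rw [Complex.im_ofReal_mul]
    exact mul_nonneg (by positivity) hα.im_nonneg
  · rw [mul_left_comm, Complex.im_ofReal_mul]
    exact mul_nonneg (by positivity) hα.im_mul_nonneg

theorem integral {X : Type*} [MeasurableSpace X] {P : Measure X} {f : X → ℂ}
    (hf : Integrable f P) (h : ∀ x, IsStieltjesValue z (f x)) :
    IsStieltjesValue z (∫ x, f x ∂P) where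
  im_nonneg := (integral_nonneg fun x => (h x).im_nonneg).trans_eq (integral_im hf)
  im_mul_nonneg := by
    rw [← integral_const_mul]
    exact (integral_nonneg fun x => (h x).im_mul_nonneg).trans_eq (integral_im (hf.const_mul z))

theorem div_norm_le_norm_one_add (hα : IsStieltjesValue z α) (hz : 0 < z.im) :
    z.im / ‖z‖ ≤ ‖1 + α‖ := by
  rw [div_le_iff₀ (norm_pos_iff.2 fun h => by simp [h] at hz), mul_comm, ← norm_mul]
  refine le_trans ?_ ((le_abs_self _).trans (Complex.abs_im_le_norm _))
  rw [mul_add, mul_one, Complex.add_im]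
  exact le_add_of_nonneg_right hα.im_mul_nonneg

theorem one_add_ne_zero (hα : IsStieltjesValue z α) (hz : 0 < z.im) : 1 + α ≠ 0 :=
  norm_pos_iff.1 <| (div_pos hz (norm_pos_iff.2 fun h => by simp [h] at hz)).trans_le
    (hα.div_norm_le_norm_one_add hz)

theorem norm_inv_one_add_le (hα : IsStieltjesValue z α) (hz : 0 < z.im) :
    ‖(1 + α)⁻¹‖ ≤ ‖z‖ / z.im := by
  rw [norm_inv, ← inv_div]
  exact inv_anti₀ (div_pos hz (norm_pos_iff.2 fun h => by simp [h] at hz))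
    (hα.div_norm_le_norm_one_add hz)

theorem im_inv_one_add_nonpos (hα : IsStieltjesValue z α) : ((1 + α)⁻¹).im ≤ 0 := by
  rw [Complex.inv_im, Complex.add_im, Complex.one_im, zero_add]
  exact div_nonpos_of_nonpos_of_nonneg (neg_nonpos.2 hα.im_nonneg) (Complex.normSq_nonneg _)

end IsStieltjesValue

section Resolvent

variable {m k : Type*} [Fintype m] [DecidableEq m] [Fintype k]

/-- The resolvent `(S - z I)⁻¹` of the matrix `S`. -/
def resolventOf (S : Matrix m m ℂ) (z : ℂ) : Matrix m m ℂ :=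
  (S - z • (1 : Matrix m m ℂ))⁻¹

variable {S : Matrix m m ℂ} {z : ℂ}

theorem star_dotProduct_sub_smul_one_mulVec (S : Matrix m m ℂ) (z : ℂ) (u : m → ℂ) :
    star u ⬝ᵥ (S - z • (1 : Matrix m m ℂ)).mulVec u =
      star u ⬝ᵥ S.mulVec u - z * ((l2Norm u ^ 2 : ℝ) : ℂ) := by
  rw [Matrix.sub_mulVec, Matrix.smul_mulVec, Matrix.one_mulVec, dotProduct_sub, dotProduct_smul,
    star_dotProduct_self, smul_eq_mul]

theorem im_quadForm_sub_smul_one_le (hS : S.PosSemidef) (z : ℂ) (u : m → ℂ) :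
    (star u ⬝ᵥ (S - z • (1 : Matrix m m ℂ)).mulVec u).im ≤ -z.im * l2Norm u ^ 2 := by
  rw [star_dotProduct_sub_smul_one_mulVec, Complex.sub_im, Complex.im_mul_ofReal,
    ← (Complex.nonneg_iff.1 (hS.dotProduct_mulVec_nonneg u)).2, zero_sub, neg_mul]

theorem isUnit_sub_smul_one (hS : S.PosSemidef) (hz : 0 < z.im) :
    IsUnit (S - z • (1 : Matrix m m ℂ)) :=
  isUnit_of_im_quadForm_le hz (im_quadForm_sub_smul_one_le hS z)

theorem l2_opNorm_resolventOf_le (hS : S.PosSemidef) (hz : 0 < z.im) :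
    ‖resolventOf S z‖ ≤ 1 / z.im :=
  l2_opNorm_inv_le_of_im_quadForm_le hz (im_quadForm_sub_smul_one_le hS z)

theorem isStieltjesValue_quadForm_resolventOf (hS : S.PosSemidef) (hz : 0 < z.im) (u : m → ℂ) :
    IsStieltjesValue z (star u ⬝ᵥ (resolventOf S z).mulVec u) := by
  set w := (resolventOf S z).mulVec u with hw
  have hu : (S - z • (1 : Matrix m m ℂ)).mulVec w = u := by
    rw [hw, resolventOf, Matrix.mulVec_mulVec, Matrix.mul_nonsing_inv _
      ((Matrix.isUnit_iff_isUnit_det _).1 (isUnit_sub_smul_one hS hz)), Matrix.one_mulVec]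
  have hform : star u ⬝ᵥ w = star (star w ⬝ᵥ S.mulVec w - z * ((l2Norm w ^ 2 : ℝ) : ℂ)) := by
    rw [← star_dotProduct_sub_smul_one_mulVec, hu, Matrix.star_dotProduct]
  obtain ⟨hre, him⟩ := Complex.nonneg_iff.1 (hS.dotProduct_mulVec_nonneg w)
  have him' : (star u ⬝ᵥ w).im = z.im * l2Norm w ^ 2 := by
    rw [hform, Complex.star_def, Complex.conj_im, Complex.sub_im, ← him, Complex.im_mul_ofReal]
    ring
  have hre' : (star u ⬝ᵥ w).re = (star w ⬝ᵥ S.mulVec w).re - z.re * l2Norm w ^ 2 := by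
    rw [hform, Complex.star_def, Complex.conj_re, Complex.sub_re, Complex.re_mul_ofReal]
  constructor
  · rw [him']
    positivity
  · calc 0 ≤ z.im * (star w ⬝ᵥ S.mulVec w).re := mul_nonneg hz.le hre
      _ = (z * (star u ⬝ᵥ w)).im := by rw [Complex.mul_im, hre', him']; ring

theorem isStieltjesValue_trace_resolventOf_mul (hS : S.PosSemidef) (hz : 0 < z.im)
    (G : Matrix m k ℂ) :
    IsStieltjesValue z (resolventOf S z * (G * G.conjTranspose)).trace := by
  have htrace : (resolventOf S z * (G * G.conjTranspose)).trace =
      ∑ i, star (G.col i) ⬝ᵥ (resolventOf S z).mulVec (G.col i) := by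
    rw [← Matrix.mul_assoc, Matrix.trace_mul_comm]
    rfl
  rw [htrace]
  exact .sum fun i _ => isStieltjesValue_quadForm_resolventOf hS hz _

theorem continuous_resolventOf {X : Type*} [TopologicalSpace X] {f : X → Matrix m m ℂ}
    (hf : Continuous f) (hS : ∀ x, (f x).PosSemidef) (hz : 0 < z.im) :
    Continuous fun x => resolventOf (f x) z := by
  refine continuous_iff_continuousAt.2 fun x => ?_
  obtain ⟨u, hu⟩ := isUnit_sub_smul_one (hS x) hz
  simp only [resolventOf, Matrix.nonsing_inv_eq_ringInverse]
  refine ContinuousAt.comp (g := Ring.inverse) ?_ (hf.sub continuous_const).continuousAt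
  rw [← hu]
  exact NormedRing.inverse_continuousAt u

section RankOne

variable {S' : Matrix m m ℂ} {w : m → ℂ} {c : ℂ}

theorem resolventOf_sub_resolventOf (hS : S.PosSemidef) (hS' : S'.PosSemidef) (hz : 0 < z.im)
    (h : S' = S + c • Matrix.vecMulVec w (star w)) :
    resolventOf S' z - resolventOf S z =
      Matrix.vecMulVec (-(c • (resolventOf S' z).mulVec w))
        (Matrix.vecMul (star w) (resolventOf S z)) := by
  have hsub : S - z • (1 : Matrix m m ℂ) - (S' - z • (1 : Matrix m m ℂ)) =
      -(c • Matrix.vecMulVec w (star w)) := by rw [h]; abel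
  rw [resolventOf, resolventOf, Matrix.inv_sub_inv
      (iff_of_true (isUnit_sub_smul_one hS' hz) (isUnit_sub_smul_one hS hz)), hsub,
    Matrix.mul_neg, Matrix.mul_smul, Matrix.neg_mul, Matrix.smul_mul, Matrix.mul_vecMulVec,
    Matrix.vecMulVec_mul, Matrix.neg_vecMulVec, Matrix.smul_vecMulVec]

theorem norm_trace_resolventOf_sub_le (hS : S.PosSemidef) (hS' : S'.PosSemidef) (hz : 0 < z.im)
    (h : S' = S + c • Matrix.vecMulVec w (star w)) (M : Matrix m m ℂ) :
    ‖(resolventOf S' z * M).trace - (resolventOf S z * M).trace‖ ≤ 2 / z.im * ‖M‖ := by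
  rw [← Matrix.trace_sub, ← Matrix.sub_mul, resolventOf_sub_resolventOf hS hS' hz h]
  refine (norm_trace_vecMulVec_mul_le _ _ _).trans ?_
  gcongr
  rw [← resolventOf_sub_resolventOf hS hS' hz h]
  calc ‖resolventOf S' z - resolventOf S z‖ ≤ 1 / z.im + 1 / z.im :=
        norm_sub_le_of_le (l2_opNorm_resolventOf_le hS' hz) (l2_opNorm_resolventOf_le hS hz)
    _ = 2 / z.im := by ring

theorem smul_resolventOf_mulVec (hS : S.PosSemidef) (hS' : S'.PosSemidef) (hz : 0 < z.im)
    (h : S' = S + c • Matrix.vecMulVec w (star w)) :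
    (1 + c * (star w ⬝ᵥ (resolventOf S z).mulVec w)) • (resolventOf S' z).mulVec w =
      (resolventOf S z).mulVec w := by
  have hw := congrArg (fun H => H.mulVec w) (resolventOf_sub_resolventOf hS hS' hz h)
  simp only [Matrix.sub_mulVec, Matrix.vecMulVec_mulVec, ← Matrix.dotProduct_mulVec,
    op_smul_eq_smul, sub_eq_iff_eq_add] at hw
  rw [add_smul, one_smul, mul_comm c, mul_smul]
  nth_rewrite 1 [hw]
  rw [smul_neg]
  abel

end RankOne

end Resolvent

section Gram

variable {m : Type*} {n : ℕ} {z : ℂ}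

/-- The sample covariance matrix `(1/n) ∑ⱼ wⱼ wⱼᴴ` of the columns `wⱼ`. -/
def gram (w : Fin n → m → ℂ) : Matrix m m ℂ :=
  (1 / (n : ℂ)) • ∑ j, Matrix.vecMulVec (w j) (star (w j))

theorem gram_eq_add (w : Fin n → m → ℂ) (j : Fin n) :
    gram w = gram (Function.update w j 0) +
      (1 / (n : ℂ)) • Matrix.vecMulVec (w j) (star (w j)) := by
  rw [gram, gram, ← smul_add, ← Finset.add_sum_erase _ _ (Finset.mem_univ j),
    ← Finset.add_sum_erase _ _ (Finset.mem_univ j), Function.update_self, star_zero,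
    Matrix.vecMulVec_zero, zero_add, add_comm]
  congr 2
  refine Finset.sum_congr rfl fun i hi => ?_
  rw [Function.update_of_ne (Finset.ne_of_mem_erase hi)]

theorem continuous_gram : Continuous fun w : Fin n → m → ℂ => gram w := by
  have hsum : Continuous fun w : Fin n → m → ℂ => ∑ j, Matrix.vecMulVec (w j) (star (w j)) :=
    continuous_finsetSum _ fun j _ =>
      (continuous_apply j).matrix_vecMulVec (continuous_star.comp (continuous_apply j))
  exact hsum.const_smul (1 / (n : ℂ))

theorem posSemidef_gram [Finite m] (w : Fin n → m → ℂ) : (gram w).PosSemidef := by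
  have := Fintype.ofFinite m
  refine (Matrix.posSemidef_sum _ fun j _ => Matrix.posSemidef_vecMulVec_self_star _).smul ?_
  exact one_div_nonneg.2 (Nat.cast_nonneg n)

variable [Fintype m] [DecidableEq m]

theorem continuous_trace_resolventOf_gram_mul (hz : 0 < z.im) (M : Matrix m m ℂ) :
    Continuous fun w : Fin n → m → ℂ => (resolventOf (gram w) z * M).trace :=
  Continuous.matrix_trace <|
    (continuous_resolventOf continuous_gram posSemidef_gram hz).matrix_mul continuous_const

theorem norm_trace_resolventOf_gram_mul_le (hz : 0 < z.im) (w : Fin n → m → ℂ)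
    (M : Matrix m m ℂ) :
    ‖(resolventOf (gram w) z * M).trace‖ ≤ Fintype.card m * (1 / z.im * ‖M‖) := by
  refine (norm_trace_le _).trans ?_
  gcongr
  exact norm_mul_le_of_le (l2_opNorm_resolventOf_le (posSemidef_gram w) hz) le_rfl

theorem norm_trace_resolventOf_gram_sub_update_le (hz : 0 < z.im) (w : Fin n → m → ℂ) (j : Fin n)
    (M : Matrix m m ℂ) :
    ‖(resolventOf (gram w) z * M).trace -
      (resolventOf (gram (Function.update w j 0)) z * M).trace‖ ≤ 2 / z.im * ‖M‖ :=
  norm_trace_resolventOf_sub_le (posSemidef_gram _) (posSemidef_gram _) hz (gram_eq_add w j) M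

theorem resolventOf_gram_mulVec_self (hz : 0 < z.im) (w : Fin n → m → ℂ) (j : Fin n) :
    (resolventOf (gram w) z).mulVec (w j) = (1 + 1 / (n : ℂ) *
      (star (w j) ⬝ᵥ (resolventOf (gram (Function.update w j 0)) z).mulVec (w j)))⁻¹ •
      (resolventOf (gram (Function.update w j 0)) z).mulVec (w j) := by
  rw [eq_inv_smul_iff₀ (((isStieltjesValue_quadForm_resolventOf (posSemidef_gram _) hz
    _).one_div_natCast_mul n).one_add_ne_zero hz)]
  exact smul_resolventOf_mulVec (posSemidef_gram _) (posSemidef_gram _) hz (gram_eq_add w j)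

end Gram

theorem memLp_two_mul {α : Type*} [MeasurableSpace α] {P : Measure α} {f g : α → ℂ}
    (hf : MemLp f 4 P) (hg : MemLp g 4 P) : MemLp (fun x => f x * g x) 2 P :=
  have : ENNReal.HolderTriple 4 4 2 := ⟨by
    rw [← two_mul, ← ENNReal.toReal_eq_toReal_iff' (by finiteness) (by finiteness)]; norm_num⟩
  hg.mul' hf

theorem norm_add_three_sq_le {V : Type*} [SeminormedAddCommGroup V] (a b c : V) :
    ‖a + b + c‖ ^ 2 ≤ 3 * (‖a‖ ^ 2 + ‖b‖ ^ 2 + ‖c‖ ^ 2) :=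
  calc ‖a + b + c‖ ^ 2 ≤ (‖a‖ + ‖b‖ + ‖c‖) ^ 2 := by gcongr; exact norm_add₃_le
    _ ≤ 3 * (‖a‖ ^ 2 + ‖b‖ ^ 2 + ‖c‖ ^ 2) := by
        nlinarith [sq_nonneg (‖a‖ - ‖b‖), sq_nonneg (‖b‖ - ‖c‖), sq_nonneg (‖a‖ - ‖c‖)]

theorem integral_norm_add_three_sq_le {α V : Type*} [MeasurableSpace α] {P : Measure α}
    [NormedAddCommGroup V] {f g h : α → V} (hf : MemLp f 2 P) (hg : MemLp g 2 P)
    (hh : MemLp h 2 P) :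
    ∫ x, ‖f x + g x + h x‖ ^ 2 ∂P ≤
      3 * (∫ x, ‖f x‖ ^ 2 ∂P + ∫ x, ‖g x‖ ^ 2 ∂P + ∫ x, ‖h x‖ ^ 2 ∂P) := by
  have hf' : Integrable (fun x => ‖f x‖ ^ 2) P := hf.norm.integrable_sq
  have hg' : Integrable (fun x => ‖g x‖ ^ 2) P := hg.norm.integrable_sq
  have hh' : Integrable (fun x => ‖h x‖ ^ 2) P := hh.norm.integrable_sq
  have hfg : Integrable (fun x => ‖f x‖ ^ 2 + ‖g x‖ ^ 2) P := hf'.add hg'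
  rw [← integral_add hf' hg', ← integral_add hfg hh', ← integral_const_mul]
  exact integral_mono ((hf.add hg).add hh).norm.integrable_sq ((hfg.add hh').const_mul 3)
    fun x => norm_add_three_sq_le _ _ _

section QuadraticForm

variable {I : Type*} [Fintype I]

section DecidableEq

variable [DecidableEq I]

theorem dotProduct_update_zero (t u : I → ℂ) (i : I) :
    t ⬝ᵥ Function.update u i 0 = Function.update t i 0 ⬝ᵥ u := by
  refine Finset.sum_congr rfl fun k _ => ?_
  by_cases hk : k = i
  · subst hk; simp
  · simp [hk]

theorem l2Norm_update_zero_le (t : I → ℂ) (i : I) : l2Norm (Function.update t i 0) ≤ l2Norm t := by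
  rw [← sq_le_sq₀ (l2Norm_nonneg _) (l2Norm_nonneg _), l2Norm_sq, l2Norm_sq]
  refine Finset.sum_le_sum fun k _ => ?_
  by_cases hk : k = i
  · subst hk; simp
  · simp [hk]

theorem quadForm_sub_update_zero (T : Matrix I I ℂ) (u : I → ℂ) (i : I) :
    star u ⬝ᵥ T.mulVec u -
        (star (Function.update u i 0) ⬝ᵥ T.mulVec (Function.update u i 0) + T i i) =
      T i i * ((‖u i‖ ^ 2 - 1 : ℝ) : ℂ) + star (u i) * (Function.update (T i) i 0 ⬝ᵥ u) +
        star (Function.update (star (T.col i)) i 0 ⬝ᵥ u) * u i := by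
  have hu : u = Function.update u i 0 + Pi.single i (u i) := by
    ext k
    by_cases hk : k = i
    · subst hk; simp
    · simp [hk]
  have hrow : Function.update (T i) i 0 ⬝ᵥ u = T.mulVec (Function.update u i 0) i :=
    (dotProduct_update_zero _ _ _).symm
  have hcol : star (Function.update (star (T.col i)) i 0 ⬝ᵥ u) =
      star (Function.update u i 0) ⬝ᵥ T.col i := by
    rw [← dotProduct_update_zero, ← Matrix.star_dotProduct_star, star_star]
  have hsq : ((‖u i‖ ^ 2 - 1 : ℝ) : ℂ) = star (u i) * u i - 1 := by
    rw [Complex.star_def, Complex.conj_mul']; push_cast; ring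
  rw [hrow, hcol, hsq]
  generalize Function.update u i 0 = w at *
  generalize u i = s at *
  subst hu
  rw [star_add, Matrix.mulVec_add, dotProduct_add, add_dotProduct, add_dotProduct, ← Pi.single_star,
    Matrix.mulVec_single, single_dotProduct, single_dotProduct, dotProduct_smul]
  simp only [Pi.smul_apply, Matrix.col_apply, MulOpposite.smul_eq_mul_unop, MulOpposite.unop_op]
  ring

end DecidableEq

/-- The law of a standardized entry whose fourth absolute moment is at most `κ`. -/
structure IsStandardLaw (ν : Measure ℂ) (κ : ℝ) : Prop where
  memLp_id : MemLp id 4 ν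
  integral_eq_zero : ∫ x, x ∂ν = 0
  integral_norm_sq : ∫ x, ‖x‖ ^ 2 ∂ν = 1
  integral_norm_pow_four_le : ∫ x, ‖x‖ ^ 4 ∂ν ≤ κ

theorem IsStandardLaw.nonneg {ν : Measure ℂ} {κ : ℝ} (hν : IsStandardLaw ν κ) : 0 ≤ κ :=
  (integral_nonneg fun x => by positivity).trans hν.integral_norm_pow_four_le

variable {ν : I → Measure ℂ} [∀ i, IsProbabilityMeasure (ν i)] {κ : ℝ}

theorem integral_pi_eval {V : Type*} [NormedAddCommGroup V] [NormedSpace ℝ V] {g : ℂ → V} (i : I)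
    (hg : AEStronglyMeasurable g (ν i)) :
    ∫ y, g (y i) ∂Measure.pi ν = ∫ x, g x ∂ν i := by
  have h := measurePreserving_eval ν i
  have hg' : AEStronglyMeasurable g ((Measure.pi ν).map (Function.eval i)) := by rwa [h.map_eq]
  rw [← h.map_eq, integral_map h.measurable.aemeasurable hg']

theorem memLp_four_eval (hν : ∀ i, IsStandardLaw (ν i) κ) (i : I) :
    MemLp (fun y : I → ℂ => y i) 4 (Measure.pi ν) :=
  (hν i).memLp_id.comp_measurePreserving (measurePreserving_eval ν i)

theorem memLp_four_dotProduct (hν : ∀ i, IsStandardLaw (ν i) κ) (t : I → ℂ) :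
    MemLp (fun y : I → ℂ => t ⬝ᵥ y) 4 (Measure.pi ν) :=
  memLp_finsetSum _ fun i _ => (memLp_four_eval hν i).const_mul (t i)

theorem memLp_two_quadForm (hν : ∀ i, IsStandardLaw (ν i) κ) (T : Matrix I I ℂ) :
    MemLp (fun y : I → ℂ => star y ⬝ᵥ T.mulVec y) 2 (Measure.pi ν) :=
  memLp_finsetSum _ fun i _ =>
    memLp_two_mul (memLp_four_eval hν i).star (memLp_four_dotProduct hν (T i))

theorem integral_star_mul_eval [DecidableEq I] (hν : ∀ i, IsStandardLaw (ν i) κ) (i k : I) :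
    ∫ y : I → ℂ, star (y i) * y k ∂Measure.pi ν = if i = k then 1 else 0 := by
  split_ifs with hik
  · subst hik
    simp only [Complex.star_def, Complex.conj_mul']
    rw [integral_pi_eval (g := fun x => (‖x‖ : ℂ) ^ 2) i (by fun_prop)]
    simp only [← Complex.ofReal_pow]
    rw [integral_complex_ofReal, (hν i).integral_norm_sq, Complex.ofReal_one]
  · have hint : Integrable (fun y : I → ℂ => star (y i) * y k) (Measure.pi ν) :=
      (memLp_two_mul (memLp_four_eval hν i).star (memLp_four_eval hν k)).integrable one_le_two
    have havg (y : I → ℂ) : avg ν k (fun y => star (y i) * y k) y = 0 := by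
      simp only [avg, Function.update_self, Function.update_of_ne hik]
      rw [← mul_zero (star (y i)), ← (hν k).integral_eq_zero]
      exact integral_const_mul _ _
    rw [← integral_avg hint k]
    simp only [havg, integral_zero]

theorem integral_quadForm (hν : ∀ i, IsStandardLaw (ν i) κ) (T : Matrix I I ℂ) :
    ∫ y : I → ℂ, star y ⬝ᵥ T.mulVec y ∂Measure.pi ν = T.trace := by
  classical
  have hint (i k : I) : Integrable (fun y : I → ℂ => star (y i) * y k) (Measure.pi ν) :=
    (memLp_two_mul (memLp_four_eval hν i).star (memLp_four_eval hν k)).integrable one_le_two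
  have hexpand (y : I → ℂ) :
      star y ⬝ᵥ T.mulVec y = ∑ i, ∑ k, T i k * (star (y i) * y k) := by
    simp only [dotProduct, Matrix.mulVec, Finset.mul_sum, Pi.star_apply]
    exact Finset.sum_congr rfl fun i _ => Finset.sum_congr rfl fun k _ => mul_left_comm _ _ _
  simp only [hexpand]
  refine (integral_finsetSum _ fun i _ =>
    integrable_finsetSum _ fun k _ => (hint i k).const_mul (T i k)).trans ?_
  refine Finset.sum_congr rfl fun i _ => ?_
  refine (integral_finsetSum _ fun k _ => (hint i k).const_mul (T i k)).trans ?_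
  simp only [integral_const_mul, integral_star_mul_eval hν, mul_ite, mul_one, mul_zero,
    Finset.sum_ite_eq, Finset.mem_univ, if_true, Matrix.diag_apply]

theorem integral_norm_dotProduct_sq (hν : ∀ i, IsStandardLaw (ν i) κ) (t : I → ℂ) :
    ∫ y : I → ℂ, ‖t ⬝ᵥ y‖ ^ 2 ∂Measure.pi ν = l2Norm t ^ 2 := by
  have h := integral_quadForm hν (Matrix.vecMulVec (star t) t)
  have hsq (y : I → ℂ) : star y ⬝ᵥ (Matrix.vecMulVec (star t) t).mulVec y =
      ((‖t ⬝ᵥ y‖ ^ 2 : ℝ) : ℂ) := by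
    rw [Matrix.vecMulVec_mulVec, dotProduct_smul, op_smul_eq_smul, smul_eq_mul,
      Matrix.star_dotProduct_star, Complex.ofReal_pow, ← Complex.conj_mul', mul_comm,
      Complex.star_def]
  simp only [hsq, Matrix.trace_vecMulVec, star_dotProduct_self] at h
  rw [integral_complex_ofReal] at h
  exact_mod_cast h

theorem integral_norm_mul_dotProduct_sq_of_apply_eq_zero (hν : ∀ i, IsStandardLaw (ν i) κ) {i : I}
    {t : I → ℂ} (ht : t i = 0) :
    ∫ y : I → ℂ, ‖star (y i) * (t ⬝ᵥ y)‖ ^ 2 ∂Measure.pi ν = l2Norm t ^ 2 := by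
  classical
  have hdot (y : I → ℂ) (x : ℂ) : t ⬝ᵥ Function.update y i x = t ⬝ᵥ y := by
    refine Finset.sum_congr rfl fun k _ => ?_
    by_cases hk : k = i
    · subst hk; rw [ht, zero_mul, zero_mul]
    · rw [Function.update_of_ne hk]
  have hint : Integrable (fun y : I → ℂ => ‖star (y i) * (t ⬝ᵥ y)‖ ^ 2) (Measure.pi ν) :=
    (memLp_two_mul (memLp_four_eval hν i).star (memLp_four_dotProduct hν t)).norm.integrable_sq
  rw [← integral_avg hint i, ← integral_norm_dotProduct_sq hν t]
  refine integral_congr_ae (Eventually.of_forall fun y => ?_)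
  simp only [avg, Function.update_self, hdot, norm_mul, norm_star, mul_pow]
  rw [integral_mul_const, (hν i).integral_norm_sq, one_mul]

theorem integral_norm_sq_sub_one_sq_le (hν : ∀ i, IsStandardLaw (ν i) κ) (i : I) :
    ∫ y : I → ℂ, (‖y i‖ ^ 2 - 1) ^ 2 ∂Measure.pi ν ≤ κ - 1 := by
  have hfour : Integrable (fun x => ‖x‖ ^ 4) (ν i) :=
    (hν i).memLp_id.integrable_norm_pow (p := 4) four_ne_zero
  have htwo : Integrable (fun x => ‖x‖ ^ 2) (ν i) :=
    ((hν i).memLp_id.mono_exponent (by norm_num)).norm.integrable_sq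
  rw [integral_pi_eval (g := fun x => (‖x‖ ^ 2 - 1) ^ 2) i (by fun_prop)]
  calc ∫ x, (‖x‖ ^ 2 - 1) ^ 2 ∂ν i = ∫ x, (‖x‖ ^ 4 - 2 * ‖x‖ ^ 2 + 1) ∂ν i := by
        congr with x; ring
    _ = ∫ x, ‖x‖ ^ 4 ∂ν i - 2 + 1 := by
        rw [integral_add, integral_sub hfour (htwo.const_mul 2), integral_const_mul,
          (hν i).integral_norm_sq, integral_const, probReal_univ, one_smul, mul_one]
        · exact hfour.sub (htwo.const_mul 2)
        · exact integrable_const 1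
    _ ≤ κ - 1 := by linarith [(hν i).integral_norm_pow_four_le]

variable [DecidableEq I]

theorem memLp_two_quadForm_update_zero (hν : ∀ i, IsStandardLaw (ν i) κ) (T : Matrix I I ℂ)
    (i : I) :
    MemLp (fun y : I → ℂ =>
      star (Function.update y i 0) ⬝ᵥ T.mulVec (Function.update y i 0) + T i i) 2
      (Measure.pi ν) := by
  have hu (k : I) : MemLp (fun y : I → ℂ => Function.update y i 0 k) 4 (Measure.pi ν) := by
    by_cases hk : k = i
    · subst hk; simp
    · simpa only [Function.update_of_ne hk] using memLp_four_eval hν k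
  refine (memLp_finsetSum _ fun k _ => memLp_two_mul (hu k).star ?_).add (memLp_const _)
  exact memLp_finsetSum _ fun l _ => (hu l).const_mul (T k l)

theorem integral_norm_mul_dotProduct_update_zero_sq_le (hν : ∀ i, IsStandardLaw (ν i) κ)
    (t : I → ℂ) (i : I) :
    ∫ y : I → ℂ, ‖star (y i) * (Function.update t i 0 ⬝ᵥ y)‖ ^ 2 ∂Measure.pi ν ≤
      l2Norm t ^ 2 := by
  rw [integral_norm_mul_dotProduct_sq_of_apply_eq_zero hν (Function.update_self _ _ _)]
  exact pow_le_pow_left₀ (l2Norm_nonneg _) (l2Norm_update_zero_le _ _) 2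

theorem integral_norm_quadForm_sub_update_zero_sq_le (hν : ∀ i, IsStandardLaw (ν i) κ)
    (T : Matrix I I ℂ) (i : I) :
    ∫ y : I → ℂ, ‖star y ⬝ᵥ T.mulVec y -
      (star (Function.update y i 0) ⬝ᵥ T.mulVec (Function.update y i 0) + T i i)‖ ^ 2
      ∂Measure.pi ν ≤ 3 * (κ + 1) * ‖T‖ ^ 2 := by
  set r := Function.update (T i) i 0 with hr
  set c := Function.update (star (T.col i)) i 0 with hc
  have hdiag : MemLp (fun y : I → ℂ => T i i * ((‖y i‖ ^ 2 - 1 : ℝ) : ℂ)) 2 (Measure.pi ν) :=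
    (((memLp_two_norm_sq (memLp_four_eval hν i)).sub (memLp_const 1)).ofReal).const_mul _
  have hrow : MemLp (fun y : I → ℂ => star (y i) * (r ⬝ᵥ y)) 2 (Measure.pi ν) :=
    memLp_two_mul (memLp_four_eval hν i).star (memLp_four_dotProduct hν r)
  have hcol : MemLp (fun y : I → ℂ => star (c ⬝ᵥ y) * y i) 2 (Measure.pi ν) :=
    memLp_two_mul (memLp_four_dotProduct hν c).star (memLp_four_eval hν i)
  have hdiag_le : ∫ y : I → ℂ, ‖T i i * ((‖y i‖ ^ 2 - 1 : ℝ) : ℂ)‖ ^ 2 ∂Measure.pi ν ≤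
      ‖T‖ ^ 2 * (κ - 1) := by
    simp only [norm_mul, mul_pow, Complex.norm_real, Real.norm_eq_abs, sq_abs, integral_const_mul]
    exact mul_le_mul (pow_le_pow_left₀ (norm_nonneg _) (norm_apply_le_l2_opNorm T i i) 2)
      (integral_norm_sq_sub_one_sq_le hν i) (integral_nonneg fun y => sq_nonneg _) (sq_nonneg _)
  have hrow_le : ∫ y : I → ℂ, ‖star (y i) * (r ⬝ᵥ y)‖ ^ 2 ∂Measure.pi ν ≤ ‖T‖ ^ 2 :=
    (integral_norm_mul_dotProduct_update_zero_sq_le hν (T i) i).trans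
      ((l2Norm_sq _).trans_le (sum_norm_sq_row_le T i))
  have hcol_le : ∫ y : I → ℂ, ‖star (c ⬝ᵥ y) * y i‖ ^ 2 ∂Measure.pi ν ≤ ‖T‖ ^ 2 := by
    have hcomm (y : I → ℂ) : ‖star (c ⬝ᵥ y) * y i‖ = ‖star (y i) * (c ⬝ᵥ y)‖ := by
      rw [norm_mul, norm_mul, norm_star, norm_star, mul_comm]
    simp only [hcomm]
    refine (integral_norm_mul_dotProduct_update_zero_sq_le hν (star (T.col i)) i).trans ?_
    rw [l2Norm_star]
    exact (l2Norm_sq _).trans_le (sum_norm_sq_col_le T i)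
  simp only [quadForm_sub_update_zero, ← hr, ← hc]
  refine (integral_norm_add_three_sq_le hdiag hrow hcol).trans ?_
  linarith

theorem variance_quadForm_le (hν : ∀ i, IsStandardLaw (ν i) κ) (T : Matrix I I ℂ) :
    ∫ y : I → ℂ, ‖star y ⬝ᵥ T.mulVec y - T.trace‖ ^ 2 ∂Measure.pi ν ≤
      3 * (κ + 1) * Fintype.card I * ‖T‖ ^ 2 := by
  rw [← integral_quadForm hν T]
  refine (efron_stein (memLp_two_quadForm hν T) (memLp_two_quadForm_update_zero hν T)
    fun i y x => by simp only [Function.update_idem]).trans ?_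
  refine (Finset.sum_le_card_nsmul _ _ _ fun i _ =>
    integral_norm_quadForm_sub_update_zero_sq_le hν T i).trans_eq ?_
  rw [Finset.card_univ, nsmul_eq_mul]
  ring

end QuadraticForm

theorem integral_norm_le_sqrt {α V : Type*} [MeasurableSpace α] {P : Measure α}
    [IsProbabilityMeasure P] [NormedAddCommGroup V] {f : α → V} (hf : MemLp f 2 P) :
    ∫ x, ‖f x‖ ∂P ≤ √(∫ x, ‖f x‖ ^ 2 ∂P) :=
  Real.le_sqrt_of_sq_le <| even_two.convexOn_pow.map_integral_le (continuous_pow 2).continuousOn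
    isClosed_univ (by simp) (hf.integrable one_le_two).norm hf.norm.integrable_sq

section Outer


theorem im_quadForm_mul_conjTranspose_smul_nonpos {m I : Type*} [Fintype m] [Fintype I]
    (G : Matrix m I ℂ) {c : ℂ} (hc : c.im ≤ 0)
    (u : m → ℂ) : (star u ⬝ᵥ (c • (G * G.conjTranspose)).mulVec u).im ≤ 0 := by
  have hform : star u ⬝ᵥ (G * G.conjTranspose).mulVec u =
      ((l2Norm (G.conjTranspose.mulVec u) ^ 2 : ℝ) : ℂ) := by
    rw [← star_dotProduct_self, Matrix.star_mulVec, Matrix.conjTranspose_conjTranspose,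
      ← Matrix.dotProduct_mulVec, Matrix.mulVec_mulVec]
  rw [Matrix.smul_mulVec, dotProduct_smul, hform, smul_eq_mul, Complex.im_mul_ofReal]
  exact mul_nonpos_of_nonpos_of_nonneg hc (sq_nonneg _)

variable {m I : Type*} [Fintype m] [DecidableEq m] [Fintype I] {n : ℕ}

/-- The matrix `-z I + (1/n) ∑ⱼ dⱼ Gⱼ Gⱼᴴ`. Its inverse is the candidate equivalent of the
resolvent of `gram` when the column `j` has covariance `Gⱼ Gⱼᴴ`. -/
def outerOf (G : Fin n → Matrix m I ℂ) (d : Fin n → ℂ) (z : ℂ) : Matrix m m ℂ :=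
  -(z • (1 : Matrix m m ℂ)) + (1 / (n : ℂ)) • ∑ j, d j • (G j * (G j).conjTranspose)

variable {G : Fin n → Matrix m I ℂ} {d : Fin n → ℂ} {z : ℂ}

theorem im_quadForm_outerOf_le (hd : ∀ j, (d j).im ≤ 0) (u : m → ℂ) :
    (star u ⬝ᵥ (outerOf G d z).mulVec u).im ≤ -z.im * l2Norm u ^ 2 := by
  rw [outerOf, Matrix.add_mulVec, Matrix.neg_mulVec, Matrix.smul_mulVec, Matrix.smul_mulVec,
    Matrix.one_mulVec, Matrix.sum_mulVec, dotProduct_add, dotProduct_neg, dotProduct_smul,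
    dotProduct_smul, dotProduct_sum, star_dotProduct_self, smul_eq_mul, smul_eq_mul,
    one_div, ← Complex.ofReal_natCast, ← Complex.ofReal_inv, Complex.add_im,
    Complex.im_ofReal_mul, Complex.im_sum, Complex.neg_im, Complex.im_mul_ofReal, ← neg_mul]
  exact add_le_of_nonpos_right <| mul_nonpos_of_nonneg_of_nonpos (by positivity) <|
    Finset.sum_nonpos fun j _ => im_quadForm_mul_conjTranspose_smul_nonpos (G j) (hd j) u

theorem isUnit_outerOf (hz : 0 < z.im) (hd : ∀ j, (d j).im ≤ 0) : IsUnit (outerOf G d z) :=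
  isUnit_of_im_quadForm_le hz (im_quadForm_outerOf_le hd)

theorem l2_opNorm_inv_outerOf_le (hz : 0 < z.im) (hd : ∀ j, (d j).im ≤ 0) :
    ‖(outerOf G d z)⁻¹‖ ≤ 1 / z.im :=
  l2_opNorm_inv_le_of_im_quadForm_le hz (im_quadForm_outerOf_le hd)

theorem trace_resolventOf_gram_sub_trace_outerOf_inv (hz : 0 < z.im) (hd : ∀ j, (d j).im ≤ 0)
    (w : Fin n → m → ℂ) (M : Matrix m m ℂ) :
    (resolventOf (gram w) z * M).trace - ((outerOf G d z)⁻¹ * M).trace =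
      1 / (n : ℂ) * ∑ j, (d j * (resolventOf (gram w) z *
          (G j * (G j).conjTranspose * ((outerOf G d z)⁻¹ * M))).trace -
        (1 + 1 / (n : ℂ) *
          (star (w j) ⬝ᵥ (resolventOf (gram (Function.update w j 0)) z).mulVec (w j)))⁻¹ *
        (star (w j) ⬝ᵥ ((outerOf G d z)⁻¹ * M *
          resolventOf (gram (Function.update w j 0)) z).mulVec (w j))) := by
  set D := (outerOf G d z)⁻¹
  have hsub : outerOf G d z - (gram w - z • (1 : Matrix m m ℂ)) =
      (1 / (n : ℂ)) • ∑ j, (d j • (G j * (G j).conjTranspose) -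
        Matrix.vecMulVec (w j) (star (w j))) := by
    rw [outerOf, gram, Finset.sum_sub_distrib, smul_sub]
    abel
  have hdiff : resolventOf (gram w) z - D =
      resolventOf (gram w) z * (outerOf G d z - (gram w - z • (1 : Matrix m m ℂ))) * D :=
    Matrix.inv_sub_inv
      (iff_of_true (isUnit_sub_smul_one (posSemidef_gram w) hz) (isUnit_outerOf hz hd))
  rw [← Matrix.trace_sub, ← Matrix.sub_mul, hdiff, hsub, Matrix.mul_smul, Matrix.smul_mul,
    Matrix.smul_mul, Matrix.trace_smul, smul_eq_mul, Matrix.mul_assoc, Matrix.mul_assoc,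
    Matrix.sum_mul, Matrix.mul_sum, Matrix.trace_sum]
  congr 1
  refine Finset.sum_congr rfl fun j _ => ?_
  rw [Matrix.sub_mul, Matrix.mul_sub, Matrix.trace_sub, Matrix.smul_mul, Matrix.mul_smul,
    Matrix.trace_smul, smul_eq_mul]
  congr 1
  rw [← Matrix.mul_assoc, Matrix.mul_vecMulVec, Matrix.trace_mul_comm, Matrix.mul_vecMulVec,
    Matrix.trace_vecMulVec, resolventOf_gram_mulVec_self hz, Matrix.mulVec_smul, smul_dotProduct,
    smul_eq_mul, Matrix.mulVec_mulVec, dotProduct_comm (Matrix.mulVec (D * M * _) _)]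

end Outer

section Columns

variable {m I : Type*} [Fintype I] {n : ℕ}

/-- The columns `Gⱼ xⱼ`. -/
def cols (G : Fin n → Matrix m I ℂ) (x : Fin n → I → ℂ) : Fin n → m → ℂ :=
  fun j => (G j).mulVec (x j)

theorem continuous_cols (G : Fin n → Matrix m I ℂ) : Continuous (cols G) :=
  continuous_pi fun j => continuous_const.matrix_mulVec (continuous_apply j)

theorem update_cols_update (G : Fin n → Matrix m I ℂ) (x : Fin n → I → ℂ) (j : Fin n)
    (y : I → ℂ) :
    Function.update (cols G (Function.update x j y)) j 0 = Function.update (cols G x) j 0 := by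
  ext k : 1
  by_cases hk : k = j
  · subst hk; simp
  · simp [cols, hk]

theorem continuous_update_cols (G : Fin n → Matrix m I ℂ) (j : Fin n) :
    Continuous fun x => Function.update (cols G x) j 0 :=
  (continuous_cols G).update j continuous_const

/-- The law of independent columns with independent entries. -/
abbrev columnLaw (ν : Fin n → I → Measure ℂ) : Measure (Fin n → I → ℂ) :=
  Measure.pi fun j => Measure.pi (ν j)

variable [Fintype m] [DecidableEq m]

/-- The matrix `Gⱼᴴ N Q₍ⱼ₎ Gⱼ`, where `Q₍ⱼ₎` is the resolvent without the column `j`; it does not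
depend on `xⱼ`. -/
def looMatrix (G : Fin n → Matrix m I ℂ) (z : ℂ) (N : Matrix m m ℂ) (j : Fin n)
    (x : Fin n → I → ℂ) : Matrix I I ℂ :=
  (G j).conjTranspose * (N * resolventOf (gram (Function.update (cols G x) j 0)) z) * G j

/-- The quadratic form `(Gⱼ xⱼ)ᴴ N Q₍ⱼ₎ (Gⱼ xⱼ)`. -/
def looForm (G : Fin n → Matrix m I ℂ) (z : ℂ) (N : Matrix m m ℂ) (j : Fin n)
    (x : Fin n → I → ℂ) : ℂ :=
  star (x j) ⬝ᵥ (looMatrix G z N j x).mulVec (x j)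

variable {G : Fin n → Matrix m I ℂ} {z : ℂ} {σ : ℝ}

theorem star_cols_dotProduct_mulVec (N : Matrix m m ℂ) (j : Fin n) (x : Fin n → I → ℂ) :
    star (cols G x j) ⬝ᵥ (N * resolventOf (gram (Function.update (cols G x) j 0)) z).mulVec
      (cols G x j) = looForm G z N j x := by
  have hcol : cols G x j = (G j).mulVec (x j) := rfl
  rw [looForm, looMatrix, hcol, Matrix.star_mulVec, ← Matrix.dotProduct_mulVec,
    Matrix.mulVec_mulVec, Matrix.mulVec_mulVec, Matrix.mul_assoc]

theorem looMatrix_update (N : Matrix m m ℂ) (j : Fin n) (x : Fin n → I → ℂ) (y : I → ℂ) :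
    looMatrix G z N j (Function.update x j y) = looMatrix G z N j x := by
  rw [looMatrix, update_cols_update, looMatrix]

theorem looForm_update (N : Matrix m m ℂ) (j : Fin n) (x : Fin n → I → ℂ) (y : I → ℂ) :
    looForm G z N j (Function.update x j y) = star y ⬝ᵥ (looMatrix G z N j x).mulVec y := by
  rw [looForm, looMatrix_update, Function.update_self]

theorem trace_looMatrix (N : Matrix m m ℂ) (j : Fin n) (x : Fin n → I → ℂ) :
    (looMatrix G z N j x).trace =
      (resolventOf (gram (Function.update (cols G x) j 0)) z *
        (G j * (G j).conjTranspose * N)).trace := by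
  rw [looMatrix, Matrix.trace_mul_comm, ← Matrix.mul_assoc, ← Matrix.mul_assoc,
    Matrix.trace_mul_comm]

theorem continuous_looMatrix (hz : 0 < z.im) (N : Matrix m m ℂ) (j : Fin n) :
    Continuous fun x => looMatrix G z N j x := by
  have hres := continuous_resolventOf (continuous_gram.comp (continuous_update_cols G j))
    (fun x => posSemidef_gram (Function.update (cols G x) j 0)) hz
  exact (continuous_const.matrix_mul (continuous_const.matrix_mul hres)).matrix_mul continuous_const

theorem continuous_looForm (hz : 0 < z.im) (N : Matrix m m ℂ) (j : Fin n) :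
    Continuous (looForm G z N j) :=
  (continuous_apply j).star.dotProduct
    ((continuous_looMatrix hz N j).matrix_mulVec (continuous_apply j))

theorem norm_mul_conjTranspose_mul_le [DecidableEq I] {G : Matrix m I ℂ} (hG : ‖G‖ ^ 2 ≤ σ)
    (N : Matrix m m ℂ) : ‖G * G.conjTranspose * N‖ ≤ σ * ‖N‖ :=
  norm_mul_le_of_le ((l2_opNorm_mul_conjTranspose_self_le G).trans hG) le_rfl

theorem norm_trace_resolventOf_mul_sub_trace_looMatrix_le [DecidableEq I] (hz : 0 < z.im)
    {j : Fin n} (hG : ‖G j‖ ^ 2 ≤ σ) (N : Matrix m m ℂ) (x : Fin n → I → ℂ) :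
    ‖(resolventOf (gram (cols G x)) z * (G j * (G j).conjTranspose * N)).trace -
      (looMatrix G z N j x).trace‖ ≤ 2 * (σ * ‖N‖ / z.im) := by
  rw [trace_looMatrix]
  refine (norm_trace_resolventOf_gram_sub_update_le hz _ j _).trans ?_
  calc 2 / z.im * ‖G j * (G j).conjTranspose * N‖ ≤ 2 / z.im * (σ * ‖N‖) := by
        gcongr; exact norm_mul_conjTranspose_mul_le hG N
    _ = 2 * (σ * ‖N‖ / z.im) := by ring

theorem l2_opNorm_looMatrix_le [DecidableEq I] (hz : 0 < z.im) {j : Fin n}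
    (hG : ‖G j‖ ^ 2 ≤ σ) (N : Matrix m m ℂ) (x : Fin n → I → ℂ) :
    ‖looMatrix G z N j x‖ ≤ σ * ‖N‖ / z.im := by
  have hQ : ‖resolventOf (gram (Function.update (cols G x) j 0)) z‖ ≤ 1 / z.im :=
    l2_opNorm_resolventOf_le (posSemidef_gram _) hz
  have hGN : ‖(G j).conjTranspose *
      (N * resolventOf (gram (Function.update (cols G x) j 0)) z)‖ ≤
        ‖G j‖ * (‖N‖ * (1 / z.im)) := by
    refine (Matrix.l2_opNorm_mul _ _).trans ?_
    rw [Matrix.l2_opNorm_conjTranspose]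
    gcongr
    exact norm_mul_le_of_le le_rfl hQ
  calc ‖looMatrix G z N j x‖ ≤ ‖G j‖ * (‖N‖ * (1 / z.im)) * ‖G j‖ :=
        (Matrix.l2_opNorm_mul _ _).trans (by gcongr)
    _ = ‖G j‖ ^ 2 * ‖N‖ / z.im := by ring
    _ ≤ σ * ‖N‖ / z.im := by gcongr

theorem norm_trace_looMatrix_le [DecidableEq I] (hz : 0 < z.im) {j : Fin n}
    (hG : ‖G j‖ ^ 2 ≤ σ) (N : Matrix m m ℂ) (x : Fin n → I → ℂ) :
    ‖(looMatrix G z N j x).trace‖ ≤ Fintype.card I * (σ * ‖N‖ / z.im) :=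
  (norm_trace_le _).trans (by gcongr; exact l2_opNorm_looMatrix_le hz hG N x)

variable {ν : Fin n → I → Measure ℂ} [∀ j i, IsProbabilityMeasure (ν j i)] {κ : ℝ}

theorem memLp_trace_resolventOf_gram_mul_comp (hz : 0 < z.im) (M : Matrix m m ℂ) (q : ENNReal)
    {f : (Fin n → I → ℂ) → Fin n → m → ℂ} (hf : Continuous f) :
    MemLp (fun x => (resolventOf (gram (f x)) z * M).trace) q (columnLaw ν) :=
  .of_bound ((continuous_trace_resolventOf_gram_mul hz M).comp hf).aestronglyMeasurable _
    (Eventually.of_forall fun _ => norm_trace_resolventOf_gram_mul_le hz _ M)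

theorem integral_norm_trace_resolventOf_sub_integral_pow_four_le (hz : 0 < z.im)
    (M : Matrix m m ℂ) :
    ∫ x, ‖(resolventOf (gram (cols G x)) z * M).trace -
      ∫ y, (resolventOf (gram (cols G y)) z * M).trace ∂columnLaw ν‖ ^ 4 ∂columnLaw ν ≤
      11 * (n : ℝ) ^ 2 * (2 / z.im * ‖M‖) ^ 4 := by
  have h := fourth_moment_le_of_bounded_differences
    (memLp_trace_resolventOf_gram_mul_comp (ν := ν) hz M 4 (continuous_cols G))
    (fun j => memLp_trace_resolventOf_gram_mul_comp hz M 4 (continuous_update_cols G j))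
    (fun j x y => by rw [update_cols_update])
    fun j x => norm_trace_resolventOf_gram_sub_update_le hz (cols G x) j M
  rwa [Fintype.card_fin] at h

theorem integral_norm_trace_resolventOf_sub_integral_le (hz : 0 < z.im) (M : Matrix m m ℂ) :
    ∫ x, ‖(resolventOf (gram (cols G x)) z * M).trace -
      ∫ y, (resolventOf (gram (cols G y)) z * M).trace ∂columnLaw ν‖ ∂columnLaw ν ≤
      √n * (2 / z.im * ‖M‖) := by
  have hmem := memLp_trace_resolventOf_gram_mul_comp (ν := ν) hz M 2 (continuous_cols G)
  have hvar := variance_le_of_bounded_differences hmem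
    (fun j => memLp_trace_resolventOf_gram_mul_comp hz M 2 (continuous_update_cols G j))
    (fun j x y => by rw [update_cols_update])
    fun j x => norm_trace_resolventOf_gram_sub_update_le hz (cols G x) j M
  rw [Fintype.card_fin] at hvar
  refine ((integral_norm_le_sqrt (hmem.sub (memLp_const _))).trans
    (Real.sqrt_le_sqrt hvar)).trans_eq ?_
  rw [Real.sqrt_mul (Nat.cast_nonneg n), Real.sqrt_sq (by positivity)]

theorem memLp_two_looForm (hν : ∀ j i, IsStandardLaw (ν j i) κ) (hz : 0 < z.im)
    (N : Matrix m m ℂ) (j : Fin n) : MemLp (looForm G z N j) 2 (columnLaw ν) := by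
  classical
  have hsq : MemLp (fun x : Fin n → I → ℂ => l2Norm (x j) ^ 2) 2 (columnLaw ν) := by
    simp only [l2Norm_sq]
    exact memLp_finsetSum _ fun i _ => memLp_two_norm_sq <|
      (memLp_four_eval (hν j) i).comp_measurePreserving (measurePreserving_eval _ j)
  refine (hsq.const_mul (‖G j‖ ^ 2 * ‖N‖ / z.im)).mono'
    (continuous_looForm hz N j).aestronglyMeasurable (Eventually.of_forall fun x => ?_)
  calc ‖looForm G z N j x‖ ≤ l2Norm (star (x j)) * l2Norm ((looMatrix G z N j x).mulVec (x j)) :=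
        norm_dotProduct_le _ _
    _ ≤ l2Norm (x j) * (‖G j‖ ^ 2 * ‖N‖ / z.im * l2Norm (x j)) := by
        rw [l2Norm_star]
        refine mul_le_mul_of_nonneg_left ((l2Norm_mulVec_le _ _).trans ?_) (l2Norm_nonneg _)
        exact mul_le_mul_of_nonneg_right (l2_opNorm_looMatrix_le hz le_rfl N x) (l2Norm_nonneg _)
    _ = ‖G j‖ ^ 2 * ‖N‖ / z.im * l2Norm (x j) ^ 2 := by ring

theorem memLp_trace_looMatrix (hz : 0 < z.im) (N : Matrix m m ℂ) (j : Fin n) (q : ENNReal) :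
    MemLp (fun x => (looMatrix G z N j x).trace) q (columnLaw ν) := by
  classical
  exact .of_bound (continuous_looMatrix hz N j).matrix_trace.aestronglyMeasurable _
    (Eventually.of_forall fun _ => norm_trace_looMatrix_le hz le_rfl N _)

theorem integral_norm_looForm_sub_trace_sq_le [DecidableEq I]
    (hν : ∀ j i, IsStandardLaw (ν j i) κ) (hz : 0 < z.im) {j : Fin n} (hG : ‖G j‖ ^ 2 ≤ σ)
    (N : Matrix m m ℂ) :
    ∫ x, ‖looForm G z N j x - (looMatrix G z N j x).trace‖ ^ 2 ∂columnLaw ν ≤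
      3 * (κ + 1) * Fintype.card I * (σ * ‖N‖ / z.im) ^ 2 := by
  have hint : Integrable (fun x => ‖looForm G z N j x - (looMatrix G z N j x).trace‖ ^ 2)
      (columnLaw ν) :=
    ((memLp_two_looForm hν hz N j).sub (memLp_trace_looMatrix hz N j 2)).norm.integrable_sq
  -- Averaging over the column `j` first freezes the matrix of the quadratic form.
  rw [← integral_avg hint j]
  have hconst : ∫ _, 3 * (κ + 1) * Fintype.card I * (σ * ‖N‖ / z.im) ^ 2 ∂columnLaw ν =
      3 * (κ + 1) * Fintype.card I * (σ * ‖N‖ / z.im) ^ 2 := by simp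
  rw [← hconst]
  refine integral_mono (integrable_avg hint j) (integrable_const _) fun x => ?_
  simp only [avg, looForm_update, looMatrix_update]
  refine (variance_quadForm_le (hν j) (looMatrix G z N j x)).trans ?_
  obtain _ | ⟨⟨i⟩⟩ := isEmpty_or_nonempty I
  · simp
  have hκ : 0 ≤ κ := (hν j i).nonneg
  gcongr
  exact l2_opNorm_looMatrix_le hz hG N x

theorem integral_norm_looForm_sub_trace_le [DecidableEq I]
    (hν : ∀ j i, IsStandardLaw (ν j i) κ) (hz : 0 < z.im) {j : Fin n} (hG : ‖G j‖ ^ 2 ≤ σ)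
    (N : Matrix m m ℂ) :
    ∫ x, ‖looForm G z N j x - (looMatrix G z N j x).trace‖ ∂columnLaw ν ≤
      √(3 * (κ + 1) * Fintype.card I) * (σ * ‖N‖ / z.im) := by
  have hσ : 0 ≤ σ := (sq_nonneg _).trans hG
  refine (integral_norm_le_sqrt
    ((memLp_two_looForm hν hz N j).sub (memLp_trace_looMatrix hz N j 2))).trans ?_
  refine (Real.sqrt_le_sqrt (integral_norm_looForm_sub_trace_sq_le hν hz hG N)).trans_eq ?_
  rw [Real.sqrt_mul' _ (sq_nonneg _), Real.sqrt_sq (by positivity)]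

end Columns

theorem norm_inv_one_add_mul_sub_le {z α β : ℂ} (hα : IsStieltjesValue z α)
    (hβ : IsStieltjesValue z β) (hz : 0 < z.im) (s t u : ℂ) :
    ‖(1 + β)⁻¹ * s - (1 + α)⁻¹ * u‖ ≤
      ‖z‖ / z.im * (‖s - t‖ + ‖z‖ / z.im * ‖α - β‖ * ‖t‖ + ‖u - t‖) := by
  have hsplit : (1 + β)⁻¹ * s - (1 + α)⁻¹ * u =
      (1 + β)⁻¹ * (s - t) + (1 + β)⁻¹ * ((1 + α)⁻¹ * (α - β) * t) - (1 + α)⁻¹ * (u - t) := by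
    have := hα.one_add_ne_zero hz
    have := hβ.one_add_ne_zero hz
    field_simp
    ring
  have hα' := hα.norm_inv_one_add_le hz
  have hβ' := hβ.norm_inv_one_add_le hz
  rw [hsplit, mul_add, mul_add]
  refine (norm_sub_le _ _).trans (add_le_add ((norm_add_le _ _).trans (add_le_add ?_ ?_)) ?_)
  · rw [norm_mul]; gcongr
  · rw [norm_mul, norm_mul, norm_mul]; gcongr
  · rw [norm_mul]; gcongr

section Bias

variable {m I : Type*} [Fintype m] [DecidableEq m] [Fintype I] {n : ℕ}

/-- The mean `(1/n) E tr (Q Gⱼ Gⱼᴴ)` of the normalized quadratic form of the column `j`, up to the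
removal of that column from `Q`. -/
def meanTrace (G : Fin n → Matrix m I ℂ) (ν : Fin n → I → Measure ℂ) (z : ℂ) (j : Fin n) : ℂ :=
  1 / (n : ℂ) *
    ∫ x, (resolventOf (gram (cols G x)) z * (G j * (G j).conjTranspose)).trace ∂columnLaw ν

/-- The deterministic equivalent of the resolvent of `gram (cols G x)` for `x` of law
`columnLaw ν`. -/
def detEquiv (G : Fin n → Matrix m I ℂ) (ν : Fin n → I → Measure ℂ) (z : ℂ) : Matrix m m ℂ :=
  (outerOf G (fun j => (1 + meanTrace G ν z j)⁻¹) z)⁻¹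

/-- The contribution of the column `j` to the leave-one-out expansion of
`tr (Q M) - tr (detEquiv M)`, for `N = detEquiv M`. -/
def biasTerm (G : Fin n → Matrix m I ℂ) (ν : Fin n → I → Measure ℂ) (z : ℂ) (N : Matrix m m ℂ)
    (j : Fin n) (x : Fin n → I → ℂ) : ℂ :=
  (1 + meanTrace G ν z j)⁻¹ *
      (resolventOf (gram (cols G x)) z * (G j * (G j).conjTranspose * N)).trace -
    (1 + 1 / (n : ℂ) * looForm G z 1 j x)⁻¹ * looForm G z N j x

variable {G : Fin n → Matrix m I ℂ} {z : ℂ} {σ κ : ℝ} {ν : Fin n → I → Measure ℂ}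

theorem isStieltjesValue_looForm (hz : 0 < z.im) (j : Fin n) (x : Fin n → I → ℂ) :
    IsStieltjesValue z (looForm G z 1 j x) := by
  rw [← star_cols_dotProduct_mulVec, one_mul]
  exact isStieltjesValue_quadForm_resolventOf (posSemidef_gram _) hz _

theorem norm_looForm_sub_meanTrace_le [DecidableEq I] (hz : 0 < z.im) {j : Fin n}
    (hG : ‖G j‖ ^ 2 ≤ σ) (x : Fin n → I → ℂ) :
    ‖1 / (n : ℂ) * looForm G z 1 j x - meanTrace G ν z j‖ ≤
      1 / n * (‖looForm G z 1 j x - (looMatrix G z 1 j x).trace‖ +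
        ‖(resolventOf (gram (cols G x)) z * (G j * (G j).conjTranspose)).trace -
          ∫ y, (resolventOf (gram (cols G y)) z * (G j * (G j).conjTranspose)).trace ∂columnLaw ν‖ +
        2 * (σ / z.im)) := by
  have hloo := norm_trace_resolventOf_mul_sub_trace_looMatrix_le hz hG 1 x
  have hσ : 0 ≤ σ := (sq_nonneg _).trans hG
  have hone : σ * ‖(1 : Matrix m m ℂ)‖ / z.im ≤ σ / z.im := by
    gcongr
    exact mul_le_of_le_one_right hσ l2_opNorm_one_le
  rw [mul_one, norm_sub_rev] at hloo
  rw [meanTrace, ← mul_sub, norm_mul, norm_div, norm_one, RCLike.norm_natCast]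
  set t := (resolventOf (gram (cols G x)) z * (G j * (G j).conjTranspose)).trace
  set e := ∫ y, (resolventOf (gram (cols G y)) z * (G j * (G j).conjTranspose)).trace ∂columnLaw ν
  gcongr
  calc ‖looForm G z 1 j x - e‖ = ‖looForm G z 1 j x - (looMatrix G z 1 j x).trace + (t - e) +
        ((looMatrix G z 1 j x).trace - t)‖ := by congr 1; ring
    _ ≤ ‖looForm G z 1 j x - (looMatrix G z 1 j x).trace‖ + ‖t - e‖ + 2 * (σ / z.im) :=
        norm_add₃_le.trans (by gcongr; exact hloo.trans (by gcongr))

variable [∀ j i, IsProbabilityMeasure (ν j i)]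

theorem isStieltjesValue_meanTrace (hz : 0 < z.im) (j : Fin n) :
    IsStieltjesValue z (meanTrace G ν z j) :=
  .one_div_natCast_mul (.integral
    ((memLp_trace_resolventOf_gram_mul_comp hz _ 1 (continuous_cols G)).integrable le_rfl)
    fun _ => isStieltjesValue_trace_resolventOf_mul (posSemidef_gram _) hz _) n

theorem im_inv_one_add_meanTrace_nonpos (hz : 0 < z.im) (j : Fin n) :
    ((1 + meanTrace G ν z j)⁻¹).im ≤ 0 :=
  (isStieltjesValue_meanTrace hz j).im_inv_one_add_nonpos

theorem l2_opNorm_detEquiv_le (hz : 0 < z.im) : ‖detEquiv G ν z‖ ≤ 1 / z.im :=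
  l2_opNorm_inv_outerOf_le hz (im_inv_one_add_meanTrace_nonpos hz)

theorem trace_resolventOf_gram_sub_trace_detEquiv (hz : 0 < z.im) (M : Matrix m m ℂ)
    (x : Fin n → I → ℂ) :
    (resolventOf (gram (cols G x)) z * M).trace - (detEquiv G ν z * M).trace =
      1 / (n : ℂ) * ∑ j, biasTerm G ν z (detEquiv G ν z * M) j x := by
  simp only [biasTerm, ← star_cols_dotProduct_mulVec, one_mul]
  exact trace_resolventOf_gram_sub_trace_outerOf_inv hz (im_inv_one_add_meanTrace_nonpos hz) _ M

theorem integrable_biasTerm (hν : ∀ j i, IsStandardLaw (ν j i) κ) (hz : 0 < z.im)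
    (N : Matrix m m ℂ) (j : Fin n) : Integrable (biasTerm G ν z N j) (columnLaw ν) := by
  have hα (x : Fin n → I → ℂ) := (isStieltjesValue_looForm (G := G) hz j x).one_div_natCast_mul n
  have hinv : Continuous fun x => (1 + 1 / (n : ℂ) * looForm G z 1 j x)⁻¹ :=
    (continuous_const.add (continuous_const.mul (continuous_looForm hz 1 j))).inv₀ fun x =>
      (hα x).one_add_ne_zero hz
  exact (((memLp_trace_resolventOf_gram_mul_comp hz _ 1 (continuous_cols G)).integrable
    le_rfl).const_mul _).sub (((memLp_two_looForm hν hz N j).integrable one_le_two).bdd_mul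
      hinv.aestronglyMeasurable (Eventually.of_forall fun x => (hα x).norm_inv_one_add_le hz))

theorem integrable_norm_looForm_sub_meanTrace (hν : ∀ j i, IsStandardLaw (ν j i) κ)
    (hz : 0 < z.im) (j : Fin n) :
    Integrable (fun x => ‖1 / (n : ℂ) * looForm G z 1 j x - meanTrace G ν z j‖) (columnLaw ν) :=
  ((((memLp_two_looForm hν hz 1 j).integrable one_le_two).const_mul _).sub
    (integrable_const _)).norm

theorem integrable_norm_looForm_sub_trace (hν : ∀ j i, IsStandardLaw (ν j i) κ)
    (hz : 0 < z.im) (N : Matrix m m ℂ) (j : Fin n) :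
    Integrable (fun x => ‖looForm G z N j x - (looMatrix G z N j x).trace‖) (columnLaw ν) :=
  (((memLp_two_looForm hν hz N j).sub (memLp_trace_looMatrix hz N j 2)).integrable one_le_two).norm

variable [DecidableEq I]

theorem integral_norm_looForm_sub_meanTrace_le (hν : ∀ j i, IsStandardLaw (ν j i) κ)
    (hz : 0 < z.im) {j : Fin n} (hG : ‖G j‖ ^ 2 ≤ σ) :
    ∫ x, ‖1 / (n : ℂ) * looForm G z 1 j x - meanTrace G ν z j‖ ∂columnLaw ν ≤
      1 / n * (σ / z.im * (√(3 * (κ + 1) * Fintype.card I) + 2 + 2 * √n)) := by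
  have hloo := integrable_norm_looForm_sub_trace (G := G) hν hz 1 j
  have htr := (((memLp_trace_resolventOf_gram_mul_comp (ν := ν) hz (G j * (G j).conjTranspose) 1
    (continuous_cols G)).integrable le_rfl).sub (integrable_const (∫ y, (resolventOf
      (gram (cols G y)) z * (G j * (G j).conjTranspose)).trace ∂columnLaw ν))).norm
  have hσ : 0 ≤ σ := (sq_nonneg _).trans hG
  refine (integral_mono (integrable_norm_looForm_sub_meanTrace hν hz j)
    (((hloo.add htr).add (integrable_const (2 * (σ / z.im)))).const_mul (1 / (n : ℝ)))
    (norm_looForm_sub_meanTrace_le hz hG)).trans ?_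
  rw [integral_const_mul]
  gcongr
  have hone : σ * ‖(1 : Matrix m m ℂ)‖ / z.im ≤ σ * 1 / z.im := by
    gcongr
    exact l2_opNorm_one_le
  have hGG : ‖G j * (G j).conjTranspose‖ ≤ σ := (l2_opNorm_mul_conjTranspose_self_le _).trans hG
  refine (integral_add (hloo.add htr) (integrable_const _)).trans_le ?_
  rw [integral_const, probReal_univ, one_smul]
  calc _ ≤ √(3 * (κ + 1) * Fintype.card I) * (σ * 1 / z.im) + √n * (2 / z.im * σ) +
        2 * (σ / z.im) := by
        gcongr
        refine (integral_add hloo htr).trans_le (add_le_add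
          ((integral_norm_looForm_sub_trace_le hν hz hG 1).trans (by gcongr))
          ((integral_norm_trace_resolventOf_sub_integral_le hz _).trans (by gcongr)))
    _ = _ := by ring

theorem norm_biasTerm_le (hz : 0 < z.im) {j : Fin n} (hG : ‖G j‖ ^ 2 ≤ σ) (N : Matrix m m ℂ)
    (x : Fin n → I → ℂ) :
    ‖biasTerm G ν z N j x‖ ≤ ‖z‖ / z.im * (2 * (σ * ‖N‖ / z.im) +
      ‖z‖ / z.im * ‖1 / (n : ℂ) * looForm G z 1 j x - meanTrace G ν z j‖ *
        (Fintype.card I * (σ * ‖N‖ / z.im)) +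
      ‖looForm G z N j x - (looMatrix G z N j x).trace‖) := by
  refine (norm_inv_one_add_mul_sub_le ((isStieltjesValue_looForm hz j x).one_div_natCast_mul n)
    (isStieltjesValue_meanTrace hz j) hz _ (looMatrix G z N j x).trace _).trans ?_
  gcongr
  · exact norm_trace_resolventOf_mul_sub_trace_looMatrix_le hz hG N x
  · exact norm_trace_looMatrix_le hz hG N x

/-- The error in `integral_norm_biasTerm_le`, per unit of `‖N‖`: `k` is the number of entries of a
column and `κ` bounds their fourth moments. It is `o(n)` when `k = O(n)` and `κ = o(n)`. -/
def biasBound (z : ℂ) (σ κ : ℝ) (k n : ℕ) : ℝ :=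
  ‖z‖ / z.im * (σ / z.im) * (2 + √(3 * (κ + 1) * k) +
    ‖z‖ / z.im * (k / n) * (σ / z.im) * (√(3 * (κ + 1) * k) + 2 + 2 * √n))

theorem biasBound_nonneg (hz : 0 < z.im) (hσ : 0 ≤ σ) (k : ℕ) : 0 ≤ biasBound z σ κ k n := by
  unfold biasBound
  positivity

theorem integral_norm_biasTerm_le (hν : ∀ j i, IsStandardLaw (ν j i) κ) (hz : 0 < z.im)
    {j : Fin n} (hG : ‖G j‖ ^ 2 ≤ σ) (N : Matrix m m ℂ) :
    ∫ x, ‖biasTerm G ν z N j x‖ ∂columnLaw ν ≤ biasBound z σ κ (Fintype.card I) n * ‖N‖ := by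
  have hσ : 0 ≤ σ := (sq_nonneg _).trans hG
  have hmean := (integrable_norm_looForm_sub_meanTrace (G := G) hν hz j).const_mul (‖z‖ / z.im)
    |>.mul_const (Fintype.card I * (σ * ‖N‖ / z.im))
  have hloo := integrable_norm_looForm_sub_trace (G := G) hν hz N j
  have hconst := integrable_const (μ := columnLaw ν) (2 * (σ * ‖N‖ / z.im))
  refine (integral_mono_of_nonneg (Eventually.of_forall fun x => norm_nonneg _)
    (((hconst.add hmean).add hloo).const_mul _)
    (Eventually.of_forall (norm_biasTerm_le hz hG N))).trans ?_
  rw [integral_const_mul, integral_add' (hconst.add hmean) hloo, integral_add' hconst hmean,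
    integral_const, probReal_univ, one_smul,
    integral_mul_const (Fintype.card I * (σ * ‖N‖ / z.im) : ℝ), integral_const_mul]
  calc _ ≤ ‖z‖ / z.im * (2 * (σ * ‖N‖ / z.im) + ‖z‖ / z.im *
        (1 / n * (σ / z.im * (√(3 * (κ + 1) * Fintype.card I) + 2 + 2 * √n))) *
          (Fintype.card I * (σ * ‖N‖ / z.im)) +
        √(3 * (κ + 1) * Fintype.card I) * (σ * ‖N‖ / z.im)) := by
        gcongr
        · exact integral_norm_looForm_sub_meanTrace_le hν hz hG
        · exact integral_norm_looForm_sub_trace_le hν hz hG N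
    _ = _ := by rw [biasBound]; ring

theorem norm_integral_trace_resolventOf_sub_le (hν : ∀ j i, IsStandardLaw (ν j i) κ)
    (hz : 0 < z.im) (hσ : 0 ≤ σ) (hG : ∀ j, ‖G j‖ ^ 2 ≤ σ) (M : Matrix m m ℂ) :
    ‖∫ x, (resolventOf (gram (cols G x)) z * M).trace ∂columnLaw ν - (detEquiv G ν z * M).trace‖ ≤
      biasBound z σ κ (Fintype.card I) n * (‖M‖ / z.im) := by
  have hX := (memLp_trace_resolventOf_gram_mul_comp (ν := ν) hz M 1
    (continuous_cols G)).integrable le_rfl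
  have hexpand : ∫ x, (resolventOf (gram (cols G x)) z * M).trace ∂columnLaw ν -
      (detEquiv G ν z * M).trace =
        1 / (n : ℂ) * ∑ j, ∫ x, biasTerm G ν z (detEquiv G ν z * M) j x ∂columnLaw ν := by
    rw [← integral_finsetSum _ fun j _ => integrable_biasTerm hν hz _ j, ← integral_const_mul]
    simp only [← trace_resolventOf_gram_sub_trace_detEquiv hz M]
    rw [integral_sub hX (integrable_const _), integral_const, probReal_univ, one_smul]
  have hb := biasBound_nonneg (n := n) (κ := κ) hz hσ (Fintype.card I)
  have hterm (j : Fin n) : ‖∫ x, biasTerm G ν z (detEquiv G ν z * M) j x ∂columnLaw ν‖ ≤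
      biasBound z σ κ (Fintype.card I) n * (‖M‖ / z.im) := by
    refine (norm_integral_le_integral_norm _).trans
      ((integral_norm_biasTerm_le hν hz (hG j) _).trans ?_)
    gcongr
    exact (norm_mul_le_of_le (l2_opNorm_detEquiv_le hz) le_rfl).trans_eq (one_div_mul_eq_div _ _)
  have hsum := norm_sum_le_of_le Finset.univ fun j _ => hterm j
  rw [Finset.sum_const, Finset.card_univ, Fintype.card_fin, nsmul_eq_mul] at hsum
  rw [hexpand, norm_mul, norm_div, norm_one, RCLike.norm_natCast]
  refine (mul_le_mul_of_nonneg_left hsum (by positivity)).trans ?_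
  rw [← mul_assoc, one_div_mul_eq_div]
  exact mul_le_of_le_one_left (by positivity) (div_self_le_one _)

end Bias

section Reduction

variable {K p n : ℕ} {A : Fin K → Matrix (Fin p) (Fin p) ℂ} {B : Fin K → Matrix (Fin n) (Fin n) ℂ}
  {z : ℂ} {τ κ : ℝ}

theorem ofReal_sqrt_re_mul_self {w : ℂ} (hw : 0 ≤ w) : ((√w.re : ℝ) : ℂ) * (√w.re : ℝ) = w := by
  obtain ⟨hre, him⟩ := Complex.le_def.1 hw
  rw [← Complex.ofReal_mul, Real.mul_self_sqrt hre]
  exact Complex.ext rfl him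

theorem sqrt_eq_diagonal {B : Matrix (Fin n) (Fin n) ℂ} (hB : B.PosSemidef) (hd : B.IsDiag) :
    CFC.sqrt B = Matrix.diagonal fun j => ((√(B j j).re : ℝ) : ℂ) := by
  refine CFC.sqrt_unique ?_ ?_
  · rw [Matrix.diagonal_mul_diagonal]
    conv_rhs => rw [← hd.diagonal_diag]
    congr 1
    exact funext fun j => ofReal_sqrt_re_mul_self hB.diag_nonneg
  · rw [Matrix.nonneg_iff_posSemidef, Matrix.posSemidef_diagonal_iff]
    exact fun j => Complex.zero_le_real.2 (Real.sqrt_nonneg _)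

/-- The matrix that maps the vector `stack Z j` of all the noise in the column `j` to the column
`j` of the data matrix: this is where the diagonality of the `B r` enters. -/
def mixing (A : Fin K → Matrix (Fin p) (Fin p) ℂ) (B : Fin K → Matrix (Fin n) (Fin n) ℂ)
    (j : Fin n) : Matrix (Fin p) (Fin K × Fin p) ℂ :=
  fun k t => CFC.sqrt (A t.1) k t.2 * ((√(B t.1 j j).re : ℝ) : ℂ)

/-- The entries of all the noise matrices, grouped by columns. -/
def stack (Z : Fin K → Matrix (Fin p) (Fin n) ℂ) (j : Fin n) (t : Fin K × Fin p) : ℂ :=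
  Z t.1 t.2 j

theorem dataMatrix_apply (hB : ∀ r, (B r).PosSemidef) (hBd : ∀ r, (B r).IsDiag)
    (Z : Fin K → Matrix (Fin p) (Fin n) ℂ) (k : Fin p) (j : Fin n) :
    dataMatrix A B Z k j = cols (mixing A B) (stack Z) j k := by
  simp only [dataMatrix, cols, mixing, stack, Matrix.sum_apply, Matrix.mulVec, dotProduct,
    Fintype.sum_prod_type]
  refine Finset.sum_congr rfl fun r _ => ?_
  rw [sqrt_eq_diagonal (hB r) (hBd r), Matrix.mul_diagonal, Matrix.mul_apply, Finset.sum_mul]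
  exact Finset.sum_congr rfl fun i _ => mul_right_comm _ _ _

theorem sampleCov_eq_gram (hB : ∀ r, (B r).PosSemidef) (hBd : ∀ r, (B r).IsDiag)
    (Z : Fin K → Matrix (Fin p) (Fin n) ℂ) :
    sampleCov A B Z = gram (cols (mixing A B) (stack Z)) := by
  rw [sampleCov, gram]
  congr 1
  ext a b
  simp only [Matrix.mul_apply, Matrix.conjTranspose_apply, dataMatrix_apply hB hBd,
    Matrix.sum_apply, Matrix.vecMulVec_apply, Pi.star_apply]

theorem resolvent_eq_resolventOf (hB : ∀ r, (B r).PosSemidef) (hBd : ∀ r, (B r).IsDiag)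
    (Z : Fin K → Matrix (Fin p) (Fin n) ℂ) (z : ℂ) :
    resolvent A B Z z = resolventOf (gram (cols (mixing A B) (stack Z))) z := by
  rw [resolvent, resolventOf, sampleCov_eq_gram hB hBd]

theorem isUnit_sampleCov_sub_smul_one (hB : ∀ r, (B r).PosSemidef) (hBd : ∀ r, (B r).IsDiag)
    (hz : 0 < z.im) (Z : Fin K → Matrix (Fin p) (Fin n) ℂ) :
    IsUnit (sampleCov A B Z - z • (1 : Matrix (Fin p) (Fin p) ℂ)) := by
  rw [sampleCov_eq_gram hB hBd]
  exact isUnit_sub_smul_one (posSemidef_gram _) hz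

theorem mixing_mul_conjTranspose (hA : ∀ r, (A r).PosSemidef) (hB : ∀ r, (B r).PosSemidef)
    (j : Fin n) : mixing A B j * (mixing A B j).conjTranspose = ∑ r, B r j j • A r := by
  ext a b
  simp only [Matrix.mul_apply, Matrix.conjTranspose_apply, mixing, Fintype.sum_prod_type,
    Matrix.sum_apply, Matrix.smul_apply, smul_eq_mul, star_mul', Complex.star_def,
    Complex.conj_ofReal]
  refine Finset.sum_congr rfl fun r _ => ?_
  have hsa : (CFC.sqrt (A r)).IsHermitian :=
    (Matrix.nonneg_iff_posSemidef.1 (CFC.sqrt_nonneg (A r))).isHermitian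
  have hAr : A r a b = ∑ i, CFC.sqrt (A r) a i * star (CFC.sqrt (A r) b i) := by
    conv_lhs => rw [← CFC.sqrt_mul_sqrt_self (A r) (Matrix.nonneg_iff_posSemidef.2 (hA r))]
    simp only [Matrix.mul_apply, hsa.apply]
  rw [hAr, Finset.mul_sum]
  conv_rhs => rw [← ofReal_sqrt_re_mul_self (hB r).diag_nonneg]
  exact Finset.sum_congr rfl fun i _ => by rw [mul_mul_mul_comm, mul_comm]; rfl

theorem l2_opNorm_mixing_sq_le (hA : ∀ r, (A r).PosSemidef) (hB : ∀ r, (B r).PosSemidef)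
    (hAτ : ∀ r, ‖A r‖ ≤ τ) (hBτ : ∀ r, ‖B r‖ ≤ τ) (j : Fin n) :
    ‖mixing A B j‖ ^ 2 ≤ K * (τ * τ) := by
  have h := Matrix.l2_opNorm_conjTranspose_mul_self (mixing A B j).conjTranspose
  rw [Matrix.conjTranspose_conjTranspose, Matrix.l2_opNorm_conjTranspose,
    mixing_mul_conjTranspose hA hB] at h
  rw [sq, ← h]
  have hr (r : Fin K) : ‖B r j j • A r‖ ≤ τ * τ := by
    rw [norm_smul]
    exact mul_le_mul ((norm_apply_le_l2_opNorm _ _ _).trans (hBτ r)) (hAτ r) (norm_nonneg _)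
      ((norm_nonneg _).trans (hBτ r))
  simpa using norm_sum_le_of_le Finset.univ fun r _ => hr r

section Law

variable {Ω : Type*} [MeasurableSpace Ω]

theorem isStandardLaw_map {μ : Measure Ω} {X : Ω → ℂ} (hX : MemLp X 4 μ) (hmean : ∫ ω, X ω ∂μ = 0)
    (hvar : ∫ ω, ‖X ω‖ ^ 2 ∂μ = 1) (hfour : ∫ ω, ‖X ω‖ ^ 4 ∂μ ≤ κ) :
    IsStandardLaw (μ.map X) κ where
  memLp_id := (memLp_map_measure_iff aestronglyMeasurable_id hX.1.aemeasurable).2 hX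
  integral_eq_zero := by rwa [integral_map hX.1.aemeasurable (by fun_prop)]
  integral_norm_sq := by rwa [integral_map hX.1.aemeasurable (by fun_prop)]
  integral_norm_pow_four_le := by rwa [integral_map hX.1.aemeasurable (by fun_prop)]

/-- The laws of the noise entries, grouped by columns. -/
def entryLaw (μ : Measure Ω) (Z : Fin K → Ω → Matrix (Fin p) (Fin n) ℂ) (j : Fin n)
    (t : Fin K × Fin p) : Measure ℂ :=
  μ.map fun ω => Z t.1 ω t.2 j

variable {μ : Measure Ω} [IsProbabilityMeasure μ] {Z : Fin K → Ω → Matrix (Fin p) (Fin n) ℂ}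

theorem isProbabilityMeasure_entryLaw (hZ : ∀ r i j, Measurable fun ω => Z r ω i j) (j : Fin n)
    (t : Fin K × Fin p) : IsProbabilityMeasure (entryLaw μ Z j t) :=
  Measure.isProbabilityMeasure_map (hZ t.1 t.2 j).aemeasurable

theorem measurePreserving_stack (hZ : ∀ r i j, Measurable fun ω => Z r ω i j)
    (hi : iIndepFun (fun (t : Fin K × Fin p × Fin n) (ω : Ω) => Z t.1 ω t.2.1 t.2.2) μ) :
    MeasurePreserving (fun ω => stack fun r => Z r ω) μ (columnLaw (entryLaw μ Z)) := by
  have := isProbabilityMeasure_entryLaw (μ := μ) hZ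
  refine ⟨measurable_pi_lambda _ fun j => measurable_pi_lambda _ fun t => hZ t.1 t.2 j, ?_⟩
  have hinj : Function.Injective fun q : Fin n × (Fin K × Fin p) => (q.2.1, q.2.2, q.1) :=
    fun a b hab => by
      simp only [Prod.mk.injEq] at hab
      exact Prod.ext hab.2.2 (Prod.ext hab.1 hab.2.1)
  have hpi : μ.map (fun ω (q : Fin n × (Fin K × Fin p)) => Z q.2.1 ω q.2.2 q.1) =
      Measure.pi fun q => entryLaw μ Z q.1 q.2 :=
    (hi.precomp hinj).map_fun_eq_pi_map fun q => (hZ q.2.1 q.2.2 q.1).aemeasurable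
  have hcurry := Measure.infinitePi_map_curry (entryLaw μ Z)
  simp only [Measure.infinitePi_eq_pi] at hcurry
  rw [columnLaw, ← hcurry, ← hpi]
  exact (Measure.map_map (MeasurableEquiv.curry (Fin n) (Fin K × Fin p) ℂ).measurable
    (measurable_pi_lambda _ fun q : Fin n × (Fin K × Fin p) => hZ q.2.1 q.2.2 q.1)).symm

theorem integral_comp_stack {V : Type*} [NormedAddCommGroup V] [NormedSpace ℝ V]
    {f : (Fin n → Fin K × Fin p → ℂ) → V} (hZ : ∀ r i j, Measurable fun ω => Z r ω i j)
    (hi : iIndepFun (fun (t : Fin K × Fin p × Fin n) (ω : Ω) => Z t.1 ω t.2.1 t.2.2) μ)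
    (hf : AEStronglyMeasurable f (columnLaw (entryLaw μ Z))) :
    ∫ ω, f (stack fun r => Z r ω) ∂μ = ∫ x, f x ∂columnLaw (entryLaw μ Z) := by
  have h := measurePreserving_stack hZ hi
  rw [← h.map_eq] at hf ⊢
  exact (integral_map h.measurable.aemeasurable hf).symm

theorem memLp_trace_resolvent_mul (hB : ∀ r, (B r).PosSemidef) (hBd : ∀ r, (B r).IsDiag)
    (hZ : ∀ r i j, Measurable fun ω => Z r ω i j) (hz : 0 < z.im) (M : Matrix (Fin p) (Fin p) ℂ)
    (q : ENNReal) : MemLp (fun ω => (resolvent A B (fun r => Z r ω) z * M).trace) q μ := by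
  simp only [resolvent_eq_resolventOf hB hBd]
  have hstack : Measurable fun ω => stack fun r => Z r ω :=
    measurable_pi_lambda _ fun j => measurable_pi_lambda _ fun t => hZ t.1 t.2 j
  exact .of_bound (((continuous_trace_resolventOf_gram_mul hz M).comp
      (continuous_cols _)).measurable.comp hstack).aestronglyMeasurable _
    (Eventually.of_forall fun ω => norm_trace_resolventOf_gram_mul_le hz _ M)

theorem integrable_trace_resolvent_mul (hB : ∀ r, (B r).PosSemidef) (hBd : ∀ r, (B r).IsDiag)
    (hZ : ∀ r i j, Measurable fun ω => Z r ω i j) (hz : 0 < z.im) (M : Matrix (Fin p) (Fin p) ℂ) :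
    Integrable (fun ω => (resolvent A B (fun r => Z r ω) z * M).trace) μ :=
  (memLp_trace_resolvent_mul hB hBd hZ hz M 1).integrable le_rfl

theorem integral_trace_resolvent_mul (hB : ∀ r, (B r).PosSemidef) (hBd : ∀ r, (B r).IsDiag)
    (hZ : ∀ r i j, Measurable fun ω => Z r ω i j)
    (hi : iIndepFun (fun (t : Fin K × Fin p × Fin n) (ω : Ω) => Z t.1 ω t.2.1 t.2.2) μ)
    (hz : 0 < z.im) (M : Matrix (Fin p) (Fin p) ℂ) :
    ∫ ω, (resolvent A B (fun r => Z r ω) z * M).trace ∂μ =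
      ∫ x, (resolventOf (gram (cols (mixing A B) x)) z * M).trace ∂columnLaw (entryLaw μ Z) := by
  simp only [resolvent_eq_resolventOf hB hBd]
  exact integral_comp_stack hZ hi ((continuous_trace_resolventOf_gram_mul hz M).comp
    (continuous_cols _)).aestronglyMeasurable

theorem integrable_hStat (hB : ∀ r, (B r).PosSemidef) (hBd : ∀ r, (B r).IsDiag)
    (hZ : ∀ r i j, Measurable fun ω => Z r ω i j) (hz : 0 < z.im) (s : Fin K) :
    Integrable (fun ω => hStat A B (fun r => Z r ω) z s) μ := by
  simp only [hStat, Matrix.trace_mul_comm (A s)]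
  exact (integrable_trace_resolvent_mul hB hBd hZ hz (A s)).const_mul _

theorem meanTrace_mixing (hA : ∀ r, (A r).PosSemidef) (hB : ∀ r, (B r).PosSemidef)
    (hBd : ∀ r, (B r).IsDiag) (hZ : ∀ r i j, Measurable fun ω => Z r ω i j)
    (hi : iIndepFun (fun (t : Fin K × Fin p × Fin n) (ω : Ω) => Z t.1 ω t.2.1 t.2.2) μ)
    (hz : 0 < z.im) (j : Fin n) :
    meanTrace (mixing A B) (entryLaw μ Z) z j =
      (p : ℂ) / n * ∑ s, (∫ ω, hStat A B (fun r => Z r ω) z s ∂μ) * B s j j := by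
  rw [meanTrace, ← integral_trace_resolvent_mul hB hBd hZ hi hz, mixing_mul_conjTranspose hA hB]
  simp only [hStat, Matrix.mul_sum, Matrix.mul_smul, Matrix.trace_sum, Matrix.trace_smul,
    smul_eq_mul, integral_const_mul]
  rw [integral_finsetSum _ fun s _ =>
    (integrable_trace_resolvent_mul hB hBd hZ hz (A s)).const_mul (B s j j),
    Finset.mul_sum, Finset.mul_sum]
  refine Finset.sum_congr rfl fun s _ => ?_
  rw [integral_const_mul]
  simp only [Matrix.trace_mul_comm (A s)]
  obtain rfl | hp := eq_or_ne p 0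
  · simp [Matrix.trace]
  · have : (p : ℂ) ≠ 0 := Nat.cast_ne_zero.2 hp
    field_simp

theorem innerMatrix_eq (hA : ∀ r, (A r).PosSemidef) (hB : ∀ r, (B r).PosSemidef)
    (hBd : ∀ r, (B r).IsDiag) (hZ : ∀ r i j, Measurable fun ω => Z r ω i j)
    (hi : iIndepFun (fun (t : Fin K × Fin p × Fin n) (ω : Ω) => Z t.1 ω t.2.1 t.2.2) μ)
    (hz : 0 < z.im) :
    innerMatrix μ A B Z z =
      Matrix.diagonal fun j => 1 + meanTrace (mixing A B) (entryLaw μ Z) z j := by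
  ext i j
  obtain rfl | hij := eq_or_ne i j
  · simp [innerMatrix, Matrix.sum_apply, meanTrace_mixing hA hB hBd hZ hi hz]
  · simp [innerMatrix, Matrix.sum_apply, hij, fun s => hBd s hij]

theorem one_add_meanTrace_mixing_ne_zero (hZ : ∀ r i j, Measurable fun ω => Z r ω i j)
    (hz : 0 < z.im) (j : Fin n) : 1 + meanTrace (mixing A B) (entryLaw μ Z) z j ≠ 0 :=
  have := isProbabilityMeasure_entryLaw (μ := μ) hZ
  (isStieltjesValue_meanTrace hz j).one_add_ne_zero hz

theorem isUnit_innerMatrix (hA : ∀ r, (A r).PosSemidef) (hB : ∀ r, (B r).PosSemidef)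
    (hBd : ∀ r, (B r).IsDiag) (hZ : ∀ r i j, Measurable fun ω => Z r ω i j)
    (hi : iIndepFun (fun (t : Fin K × Fin p × Fin n) (ω : Ω) => Z t.1 ω t.2.1 t.2.2) μ)
    (hz : 0 < z.im) : IsUnit (innerMatrix μ A B Z z) := by
  rw [innerMatrix_eq hA hB hBd hZ hi hz, Matrix.isUnit_diagonal, Pi.isUnit_iff]
  exact fun j => (one_add_meanTrace_mixing_ne_zero hZ hz j).isUnit

theorem outerMatrix_eq (hA : ∀ r, (A r).PosSemidef) (hB : ∀ r, (B r).PosSemidef)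
    (hBd : ∀ r, (B r).IsDiag) (hZ : ∀ r i j, Measurable fun ω => Z r ω i j)
    (hi : iIndepFun (fun (t : Fin K × Fin p × Fin n) (ω : Ω) => Z t.1 ω t.2.1 t.2.2) μ)
    (hz : 0 < z.im) :
    outerMatrix μ A B Z z =
      outerOf (mixing A B) (fun j => (1 + meanTrace (mixing A B) (entryLaw μ Z) z j)⁻¹) z := by
  have hinv : (innerMatrix μ A B Z z)⁻¹ =
      Matrix.diagonal fun j => (1 + meanTrace (mixing A B) (entryLaw μ Z) z j)⁻¹ := by
    rw [innerMatrix_eq hA hB hBd hZ hi hz]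
    refine Matrix.inv_eq_right_inv ?_
    rw [Matrix.diagonal_mul_diagonal, ← Matrix.diagonal_one]
    congr 1
    exact funext fun j => mul_inv_cancel₀ (one_add_meanTrace_mixing_ne_zero hZ hz j)
  rw [outerMatrix, outerOf, hinv]
  congr 1
  simp only [mixing_mul_conjTranspose hA hB, Matrix.trace, Matrix.diag, Matrix.mul_diagonal,
    Finset.smul_sum, smul_smul, Finset.mul_sum, Finset.sum_smul]
  rw [Finset.sum_comm]
  refine Finset.sum_congr rfl fun j _ => Finset.sum_congr rfl fun r _ => ?_
  rw [mul_comm (B r j j)]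

theorem isUnit_outerMatrix (hA : ∀ r, (A r).PosSemidef) (hB : ∀ r, (B r).PosSemidef)
    (hBd : ∀ r, (B r).IsDiag) (hZ : ∀ r i j, Measurable fun ω => Z r ω i j)
    (hi : iIndepFun (fun (t : Fin K × Fin p × Fin n) (ω : Ω) => Z t.1 ω t.2.1 t.2.2) μ)
    (hz : 0 < z.im) : IsUnit (outerMatrix μ A B Z z) := by
  have := isProbabilityMeasure_entryLaw (μ := μ) hZ
  rw [outerMatrix_eq hA hB hBd hZ hi hz]
  exact isUnit_outerOf hz (im_inv_one_add_meanTrace_nonpos hz)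

theorem Qbar_eq_detEquiv (hA : ∀ r, (A r).PosSemidef) (hB : ∀ r, (B r).PosSemidef)
    (hBd : ∀ r, (B r).IsDiag) (hZ : ∀ r i j, Measurable fun ω => Z r ω i j)
    (hi : iIndepFun (fun (t : Fin K × Fin p × Fin n) (ω : Ω) => Z t.1 ω t.2.1 t.2.2) μ)
    (hz : 0 < z.im) : Qbar μ A B Z z = detEquiv (mixing A B) (entryLaw μ Z) z := by
  rw [Qbar, outerMatrix_eq hA hB hBd hZ hi hz, detEquiv]

theorem integral_norm_trace_resolvent_sub_integral_pow_four_le (hB : ∀ r, (B r).PosSemidef)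
    (hBd : ∀ r, (B r).IsDiag) (hZ : ∀ r i j, Measurable fun ω => Z r ω i j)
    (hi : iIndepFun (fun (t : Fin K × Fin p × Fin n) (ω : Ω) => Z t.1 ω t.2.1 t.2.2) μ)
    (hz : 0 < z.im) (M : Matrix (Fin p) (Fin p) ℂ) :
    ∫ ω, ‖(resolvent A B (fun r => Z r ω) z * M).trace -
      ∫ ω', (resolvent A B (fun r => Z r ω') z * M).trace ∂μ‖ ^ 4 ∂μ ≤
      11 * (n : ℝ) ^ 2 * (2 / z.im * ‖M‖) ^ 4 := by
  have := isProbabilityMeasure_entryLaw (μ := μ) hZ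
  have hcont : Continuous fun x => (resolventOf (gram (cols (mixing A B) x)) z * M).trace :=
    (continuous_trace_resolventOf_gram_mul hz M).comp (continuous_cols _)
  rw [integral_trace_resolvent_mul hB hBd hZ hi hz]
  simp only [resolvent_eq_resolventOf hB hBd]
  exact (integral_comp_stack hZ hi
      ((hcont.sub continuous_const).norm.pow 4).aestronglyMeasurable).trans_le
    (integral_norm_trace_resolventOf_sub_integral_pow_four_le hz M)

theorem norm_integral_trace_resolvent_sub_trace_Qbar_le (hA : ∀ r, (A r).PosSemidef)
    (hB : ∀ r, (B r).PosSemidef) (hBd : ∀ r, (B r).IsDiag) (hAτ : ∀ r, ‖A r‖ ≤ τ)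
    (hBτ : ∀ r, ‖B r‖ ≤ τ) (hZ : ∀ r i j, Measurable fun ω => Z r ω i j)
    (hi : iIndepFun (fun (t : Fin K × Fin p × Fin n) (ω : Ω) => Z t.1 ω t.2.1 t.2.2) μ)
    (hstd : ∀ j t, IsStandardLaw (entryLaw μ Z j t) κ) (hz : 0 < z.im)
    (M : Matrix (Fin p) (Fin p) ℂ) :
    ‖∫ ω, (resolvent A B (fun r => Z r ω) z * M).trace ∂μ - (Qbar μ A B Z z * M).trace‖ ≤
      biasBound z (K * (τ * τ)) κ (K * p) n * (‖M‖ / z.im) := by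
  have := isProbabilityMeasure_entryLaw (μ := μ) hZ
  have hcard : Fintype.card (Fin K × Fin p) = K * p := by simp
  rw [integral_trace_resolvent_mul hB hBd hZ hi hz, Qbar_eq_detEquiv hA hB hBd hZ hi hz, ← hcard]
  exact norm_integral_trace_resolventOf_sub_le hstd hz
    (mul_nonneg K.cast_nonneg (mul_self_nonneg τ)) (l2_opNorm_mixing_sq_le hA hB hAτ hBτ) M

end Law

end Reduction

section AlmostSure

variable {Ω E : Type*} [MeasurableSpace Ω] {μ : Measure Ω} [NormedAddCommGroup E]

theorem ae_summable_of_summable_integral {f : ℕ → Ω → ℝ} (hf0 : ∀ n ω, 0 ≤ f n ω)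
    (hf : ∀ n, Integrable (f n) μ) (hs : Summable fun n => ∫ ω, f n ω ∂μ) :
    ∀ᵐ ω ∂μ, Summable fun n => f n ω := by
  have hmeas (n : ℕ) : AEMeasurable (fun ω => ENNReal.ofReal (f n ω)) μ :=
    (hf n).1.aemeasurable.ennreal_ofReal
  have htsum : ∫⁻ ω, ∑' n, ENNReal.ofReal (f n ω) ∂μ ≠ ⊤ := by
    rw [lintegral_tsum hmeas]
    simp only [← fun n => ofReal_integral_eq_lintegral_ofReal (hf n) (.of_forall (hf0 n))]
    exact hs.tsum_ofReal_ne_top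
  filter_upwards [ae_lt_top' (AEMeasurable.tsum hmeas) htsum] with ω hω
  refine (ENNReal.summable_toReal hω.ne).congr fun n => ?_
  rw [ENNReal.toReal_ofReal (hf0 n ω)]

theorem tendsto_zero_of_norm_pow {u : ℕ → E} {q : ℕ} (hq : q ≠ 0)
    (h : Tendsto (fun n => ‖u n‖ ^ q) atTop (𝓝 0)) : Tendsto u atTop (𝓝 0) := by
  have hroot := h.rpow_const (p := (q : ℝ)⁻¹) (.inr (by positivity))
  rw [Real.zero_rpow (by positivity)] at hroot
  rw [tendsto_zero_iff_norm_tendsto_zero]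
  exact hroot.congr fun n => Real.pow_rpow_inv_natCast (norm_nonneg _) hq

theorem ae_tendsto_zero_of_summable_integral_norm_pow {X : ℕ → Ω → E} {q : ℕ} (hq : q ≠ 0)
    (hX : ∀ n, MemLp (X n) q μ) (hs : Summable fun n => ∫ ω, ‖X n ω‖ ^ q ∂μ) :
    ∀ᵐ ω ∂μ, Tendsto (fun n => X n ω) atTop (𝓝 0) := by
  filter_upwards [ae_summable_of_summable_integral (fun n ω => pow_nonneg (norm_nonneg (X n ω)) q)
    (fun n => (hX n).integrable_norm_pow hq) hs] with ω hω
  exact tendsto_zero_of_norm_pow hq hω.tendsto_atTop_zero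

end AlmostSure

theorem isLittleO_biasBound {k : ℕ → ℕ} {κ : ℕ → ℝ}
    (hk : (fun n => (k n : ℝ)) =O[atTop] fun n => (n : ℝ)) (hκ : κ =o[atTop] fun n => (n : ℝ))
    (z : ℂ) (σ : ℝ) : (fun n => biasBound z σ (κ n) (k n) n) =o[atTop] fun n => (n : ℝ) := by
  have hconst (c : ℝ) : (fun _ => c) =o[atTop] fun n : ℕ => (n : ℝ) :=
    isLittleO_const_left.2 (.inr (tendsto_norm_atTop_atTop.comp tendsto_natCast_atTop_atTop))
  have sqrt_isLittleO {f : ℕ → ℝ} (hf : f =o[atTop] fun n => (n : ℝ) * n) :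
      (fun n => √(f n)) =o[atTop] fun n => (n : ℝ) :=
    (hf.sqrt (.of_forall fun n => mul_self_nonneg (n : ℝ))).congr_right fun n =>
      Real.sqrt_mul_self n.cast_nonneg
  have hmoment : (fun n => √(3 * (κ n + 1) * k n)) =o[atTop] fun n => (n : ℝ) :=
    sqrt_isLittleO (((hκ.add (hconst 1)).const_mul_left 3).mul_isBigO hk)
  have hsqrt : (fun n : ℕ => √(n : ℝ)) =o[atTop] fun n => (n : ℝ) :=
    sqrt_isLittleO (((hconst 1).mul_isBigO (isBigO_refl (fun n : ℕ => (n : ℝ)) _)).congr_left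
      fun _ => one_mul _)
  have hratio : (fun n => (k n : ℝ) / n) =O[atTop] fun _ => (1 : ℝ) :=
    (hk.mul (isBigO_refl (fun n : ℕ => (n : ℝ)⁻¹) _)).trans
      (.of_bound 1 (.of_forall fun _ => by simpa using mul_inv_le_one))
  have hfactor : (fun n => ‖z‖ / z.im * ((k n : ℝ) / n) * (σ / z.im)) =O[atTop] fun _ => (1 : ℝ) :=
    ((hratio.const_mul_left (‖z‖ / z.im)).mul
      (isBigO_const_const (σ / z.im) one_ne_zero atTop)).congr_right fun _ => mul_one 1
  exact (((hconst 2).add hmoment).add ((hfactor.mul_isLittleO ((hmoment.add (hconst 2)).add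
    (hsqrt.const_mul_left 2))).congr_right fun _ => one_mul _)).const_mul_left _

section Sequence

variable {Ω : Type*} [MeasurableSpace Ω] {μ : Measure Ω} [IsProbabilityMeasure μ] {K : ℕ}
  {p : ℕ → ℕ} {A : (n : ℕ) → Fin K → Matrix (Fin (p n)) (Fin (p n)) ℂ}
  {B : (n : ℕ) → Fin K → Matrix (Fin n) (Fin n) ℂ}
  {Z : (n : ℕ) → Fin K → Ω → Matrix (Fin (p n)) (Fin n) ℂ}
  {M : (n : ℕ) → Matrix (Fin (p n)) (Fin (p n)) ℂ} {C τ : ℝ} {κ : ℕ → ℝ} {z : ℂ}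

theorem ae_tendsto_trace_resolvent_sub_integral
    (hp : (fun n : ℕ => (n : ℝ)) =O[atTop] fun n => (p n : ℝ))
    (hB : ∀ n r, (B n r).PosSemidef) (hBd : ∀ n r, (B n r).IsDiag)
    (hZ : ∀ n r i j, Measurable fun ω => Z n r ω i j)
    (hi : ∀ n, iIndepFun
      (fun (t : Fin K × Fin (p n) × Fin n) (ω : Ω) => Z n t.1 ω t.2.1 t.2.2) μ)
    (hM : ∀ n, ‖M n‖ ≤ C) (hz : 0 < z.im) :
    ∀ᵐ ω ∂μ, Tendsto (fun n => 1 / (p n : ℂ) *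
      ((resolvent (A n) (B n) (fun r => Z n r ω) z * M n).trace -
        ∫ ω', (resolvent (A n) (B n) (fun r => Z n r ω') z * M n).trace ∂μ)) atTop (𝓝 0) := by
  refine ae_tendsto_zero_of_summable_integral_norm_pow four_ne_zero
    (fun n => ((memLp_trace_resolvent_mul (hB n) (hBd n) (hZ n) hz (M n) 4).sub
      (memLp_const _)).const_mul _) ?_
  refine summable_of_isBigO_nat (Real.summable_one_div_nat_pow.2 one_lt_two) ?_
  have hinv : (fun n => 1 / (p n : ℂ)) =O[atTop] fun n : ℕ => (n : ℝ)⁻¹ := by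
    refine .of_norm_left ((hp.inv_rev ?_).congr_left fun n => by simp)
    filter_upwards [eventually_ne_atTop 0] with n hn h0 using absurd h0 (Nat.cast_ne_zero.2 hn)
  have hmoment : (fun n => ∫ ω, ‖(resolvent (A n) (B n) (fun r => Z n r ω) z * M n).trace -
      ∫ ω', (resolvent (A n) (B n) (fun r => Z n r ω') z * M n).trace ∂μ‖ ^ 4 ∂μ) =O[atTop]
        fun n => (n : ℝ) ^ 2 := by
    refine .of_bound (11 * (2 / z.im * C) ^ 4) (.of_forall fun n => ?_)
    rw [Real.norm_of_nonneg (integral_nonneg fun ω => by positivity),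
      Real.norm_of_nonneg (sq_nonneg _), mul_right_comm]
    refine (integral_norm_trace_resolvent_sub_integral_pow_four_le (hB n) (hBd n) (hZ n) (hi n) hz
      (M n)).trans ?_
    gcongr
    exact hM n
  simp only [norm_mul, mul_pow, integral_const_mul]
  refine ((hinv.norm_left.pow 4).mul hmoment).congr_right fun n => ?_
  obtain rfl | hn := eq_or_ne n 0
  · simp
  · have : (n : ℝ) ≠ 0 := Nat.cast_ne_zero.2 hn
    field_simp

theorem tendsto_integral_trace_resolvent_sub_trace_Qbar
    (hp : (fun n => (p n : ℝ)) =Θ[atTop] fun n => (n : ℝ))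
    (hA : ∀ n r, (A n r).PosSemidef) (hB : ∀ n r, (B n r).PosSemidef)
    (hAτ : ∀ n r, ‖A n r‖ ≤ τ) (hBτ : ∀ n r, ‖B n r‖ ≤ τ) (hBd : ∀ n r, (B n r).IsDiag)
    (hZ : ∀ n r i j, Measurable fun ω => Z n r ω i j)
    (hi : ∀ n, iIndepFun
      (fun (t : Fin K × Fin (p n) × Fin n) (ω : Ω) => Z n t.1 ω t.2.1 t.2.2) μ)
    (hstd : ∀ n j t, IsStandardLaw (entryLaw μ (Z n) j t) (κ n))
    (hκ : κ =o[atTop] fun n => (n : ℝ)) (hM : ∀ n, ‖M n‖ ≤ C) (hz : 0 < z.im) :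
    Tendsto (fun n => 1 / (p n : ℂ) *
      (∫ ω, (resolvent (A n) (B n) (fun r => Z n r ω) z * M n).trace ∂μ -
        (Qbar μ (A n) (B n) (Z n) z * M n).trace)) atTop (𝓝 0) := by
  have hKp : (fun n => ((K * p n : ℕ) : ℝ)) =O[atTop] fun n => (n : ℝ) := by
    simpa only [Nat.cast_mul] using hp.1.const_mul_left (K : ℝ)
  have hbias : (fun n => ∫ ω, (resolvent (A n) (B n) (fun r => Z n r ω) z * M n).trace ∂μ -
      (Qbar μ (A n) (B n) (Z n) z * M n).trace) =o[atTop] fun n => (n : ℝ) := by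
    refine IsBigO.trans_isLittleO (.of_bound (C / z.im) (.of_forall fun n => ?_))
      (isLittleO_biasBound hKp hκ z (K * (τ * τ)))
    have hb := biasBound_nonneg (n := n) (κ := κ n) hz
      (mul_nonneg K.cast_nonneg (mul_self_nonneg τ)) (K * p n)
    rw [Real.norm_of_nonneg hb, mul_comm]
    refine (norm_integral_trace_resolvent_sub_trace_Qbar_le (hA n) (hB n) (hBd n) (hAτ n) (hBτ n)
      (hZ n) (hi n) (hstd n) hz (M n)).trans ?_
    gcongr
    exact hM n
  have hdiv : (fun n => ∫ ω, (resolvent (A n) (B n) (fun r => Z n r ω) z * M n).trace ∂μ -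
      (Qbar μ (A n) (B n) (Z n) z * M n).trace) =o[atTop] fun n => (p n : ℂ) := by
    simpa only [Complex.ofReal_natCast] using
      Complex.isLittleO_ofReal_right.2 (hbias.trans_isBigO hp.2)
  exact hdiv.tendsto_div_nhds_zero.congr fun n => (one_div_mul_eq_div _ _).symm

theorem isDeterministicEquivalent_Qbar
    (hp : (fun n => (p n : ℝ)) =Θ[atTop] fun n => (n : ℝ))
    (hA : ∀ n r, (A n r).PosSemidef) (hB : ∀ n r, (B n r).PosSemidef)
    (hAτ : ∀ n r, ‖A n r‖ ≤ τ) (hBτ : ∀ n r, ‖B n r‖ ≤ τ) (hBd : ∀ n r, (B n r).IsDiag)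
    (hZ : ∀ n r i j, Measurable fun ω => Z n r ω i j)
    (hi : ∀ n, iIndepFun
      (fun (t : Fin K × Fin (p n) × Fin n) (ω : Ω) => Z n t.1 ω t.2.1 t.2.2) μ)
    (hstd : ∀ n j t, IsStandardLaw (entryLaw μ (Z n) j t) (κ n))
    (hκ : κ =o[atTop] fun n => (n : ℝ)) (hz : 0 < z.im) :
    IsDeterministicEquivalent μ (fun n ω => resolvent (A n) (B n) (fun r => Z n r ω) z)
      (fun n => Qbar μ (A n) (B n) (Z n) z) := by
  rintro M ⟨C, hM⟩
  have hbias :=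
    tendsto_integral_trace_resolvent_sub_trace_Qbar hp hA hB hAτ hBτ hBd hZ hi hstd hκ hM hz
  filter_upwards [ae_tendsto_trace_resolvent_sub_integral (A := A) hp.2 hB hBd hZ hi hM hz]
    with ω hω
  rw [← add_zero (0 : ℂ)]
  refine (hω.add hbias).congr fun n => ?_
  rw [← mul_add, sub_add_sub_cancel, Matrix.sub_mul, Matrix.trace_sub]

end Sequence

section BoundedEntries

variable {Ω : Type*} [MeasurableSpace Ω] {μ : Measure Ω} {X : Ω → ℂ} {L : ℝ}

theorem integral_norm_pow_four_le_sq (hL : ∀ᵐ ω ∂μ, ‖X ω‖ ≤ L)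
    (hvar : ∫ ω, ‖X ω‖ ^ 2 ∂μ = 1) : ∫ ω, ‖X ω‖ ^ 4 ∂μ ≤ L ^ 2 := by
  have hint : Integrable (fun ω => ‖X ω‖ ^ 2) μ := .of_integral_ne_zero (hvar ▸ one_ne_zero)
  calc ∫ ω, ‖X ω‖ ^ 4 ∂μ ≤ ∫ ω, L ^ 2 * ‖X ω‖ ^ 2 ∂μ := by
        refine integral_mono_of_nonneg (.of_forall fun ω => by positivity) (hint.const_mul _) ?_
        filter_upwards [hL] with ω hω
        calc ‖X ω‖ ^ 4 = ‖X ω‖ ^ 2 * ‖X ω‖ ^ 2 := by ring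
          _ ≤ L ^ 2 * ‖X ω‖ ^ 2 := by gcongr
    _ = L ^ 2 := by rw [integral_const_mul, hvar, mul_one]

theorem isLittleO_rpow_sq_natCast {a : ℝ} (ha : a < 1 / 2) :
    (fun n : ℕ => ((n : ℝ) ^ a) ^ 2) =o[atTop] fun n => (n : ℝ) := by
  have hlim := (tendsto_rpow_neg_atTop (y := 1 - a * 2) (by linarith)).comp
    tendsto_natCast_atTop_atTop
  refine isLittleO_of_tendsto' ?_ (hlim.congr' ?_) <;>
    filter_upwards [eventually_gt_atTop 0] with n hn
  · exact fun h0 => absurd h0 (Nat.cast_ne_zero.2 hn.ne')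
  · rw [Function.comp_apply, neg_sub, Real.rpow_sub_one (Nat.cast_ne_zero.2 hn.ne'),
      Real.rpow_mul n.cast_nonneg, Real.rpow_ofNat]

end BoundedEntries

end SumSeparable

end

open Asymptotics in
theorem theorem4p6_general {Ω : Type*} [MeasurableSpace Ω] {μ : Measure Ω} [IsProbabilityMeasure μ]
    {K : ℕ} {p : ℕ → ℕ} (hp : (fun n => (p n : ℝ)) =Θ[atTop] fun n => (n : ℝ))
    {A : (n : ℕ) → Fin K → Matrix (Fin (p n)) (Fin (p n)) ℂ}
    {B : (n : ℕ) → Fin K → Matrix (Fin n) (Fin n) ℂ}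
    {Z : (n : ℕ) → Fin K → Ω → Matrix (Fin (p n)) (Fin n) ℂ}
    (hA : ∀ n r, (A n r).PosSemidef) (hB : ∀ n r, (B n r).PosSemidef)
    {τ : ℝ} (hAτ : ∀ n r, ‖A n r‖ ≤ τ) (hBτ : ∀ n r, ‖B n r‖ ≤ τ)
    (hBdiag : ∀ n r, (B n r).IsDiag)
    (hZmeas : ∀ n r i j, Measurable fun ω => Z n r ω i j)
    (hZindep : ∀ n, iIndepFun
      (fun (t : Fin K × Fin (p n) × Fin n) (ω : Ω) => Z n t.1 ω t.2.1 t.2.2) μ)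
    (hZmem : ∀ n r i j, MemLp (fun ω => Z n r ω i j) 4 μ)
    (hZmean : ∀ n r i j, ∫ ω, Z n r ω i j ∂μ = 0)
    (hZvar : ∀ n r i j, ∫ ω, ‖Z n r ω i j‖ ^ 2 ∂μ = 1)
    {κ : ℕ → ℝ} (hκ : κ =o[atTop] fun n => (n : ℝ))
    (hZfour : ∀ n r i j, ∫ ω, ‖Z n r ω i j‖ ^ 4 ∂μ ≤ κ n)
    {z : ℂ} (hz : 0 < z.im) :
    (∀ n ω, IsUnit (SumSeparable.sampleCov (A n) (B n) (fun r => Z n r ω) -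
      z • (1 : Matrix (Fin (p n)) (Fin (p n)) ℂ))) ∧
    (∀ n s, Integrable
      (fun ω => SumSeparable.hStat (A n) (B n) (fun r => Z n r ω) z s) μ) ∧
    (∀ n, IsUnit (SumSeparable.innerMatrix μ (A n) (B n) (Z n) z)) ∧
    (∀ n, IsUnit (SumSeparable.outerMatrix μ (A n) (B n) (Z n) z)) ∧
    SumSeparable.IsDeterministicEquivalent μ
      (fun n ω => SumSeparable.resolvent (A n) (B n) (fun r => Z n r ω) z)
      (fun n => SumSeparable.Qbar μ (A n) (B n) (Z n) z) :=
  ⟨fun n _ => SumSeparable.isUnit_sampleCov_sub_smul_one (hB n) (hBdiag n) hz _,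
    fun n => SumSeparable.integrable_hStat (hB n) (hBdiag n) (hZmeas n) hz,
    fun n => SumSeparable.isUnit_innerMatrix (hA n) (hB n) (hBdiag n) (hZmeas n) (hZindep n) hz,
    fun n => SumSeparable.isUnit_outerMatrix (hA n) (hB n) (hBdiag n) (hZmeas n) (hZindep n) hz,
    SumSeparable.isDeterministicEquivalent_Qbar hp hA hB hAτ hBτ hBdiag hZmeas hZindep
      (fun n j t => SumSeparable.isStandardLaw_map (hZmem n t.1 t.2 j) (hZmean n t.1 t.2 j)
        (hZvar n t.1 t.2 j) (hZfour n t.1 t.2 j)) hκ hz⟩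

theorem theorem4p6 {Ω : Type*} [MeasurableSpace Ω] (μ : Measure Ω) [IsProbabilityMeasure μ]
    (K : ℕ) (p : ℕ → ℕ) (c : ℝ) (hc : 0 < c)
    (hpn : Tendsto (fun n : ℕ => (p n : ℝ) / (n : ℝ)) atTop (𝓝 c))
    (A : (n : ℕ) → Fin K → Matrix (Fin (p n)) (Fin (p n)) ℂ)
    (B : (n : ℕ) → Fin K → Matrix (Fin n) (Fin n) ℂ)
    (Z : (n : ℕ) → Fin K → Ω → Matrix (Fin (p n)) (Fin n) ℂ)
    (hA : ∀ n r, (A n r).PosSemidef) (hB : ∀ n r, (B n r).PosSemidef)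
    (τ : ℝ) (hτ : 0 < τ) (hAτ : ∀ n r, ‖A n r‖ ≤ τ) (hBτ : ∀ n r, ‖B n r‖ ≤ τ)
    (hBdiag : ∀ n r, (B n r).IsDiag)
    (hZmeas : ∀ n r i j, Measurable fun ω => Z n r ω i j)
    (hZindep : ∀ n, iIndepFun
      (fun (t : Fin K × Fin (p n) × Fin n) (ω : Ω) => Z n t.1 ω t.2.1 t.2.2) μ)
    (hZmean : ∀ n r i j, ∫ ω, Z n r ω i j ∂μ = 0)
    (hZvar : ∀ n r i j, ∫ ω, ‖Z n r ω i j‖ ^ 2 ∂μ = 1)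
    (η₀ a : ℝ) (hη₀ : 0 < η₀) (ha : 1 / (4 + η₀) < a) (ha' : a < 1 / 4)
    (hZbdd : ∀ n r i j, ∀ᵐ ω ∂μ, ‖Z n r ω i j‖ ≤ (n : ℝ) ^ a)
    (z : ℂ) (hz : 0 < z.im) :
    -- all the inverses and expectations involved are genuine
    (∀ n ω, IsUnit (SumSeparable.sampleCov (A n) (B n) (fun r => Z n r ω) -
      z • (1 : Matrix (Fin (p n)) (Fin (p n)) ℂ))) ∧
    (∀ n s, Integrable
      (fun ω => SumSeparable.hStat (A n) (B n) (fun r => Z n r ω) z s) μ) ∧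
    (∀ n, IsUnit (SumSeparable.innerMatrix μ (A n) (B n) (Z n) z)) ∧
    (∀ n, IsUnit (SumSeparable.outerMatrix μ (A n) (B n) (Z n) z)) ∧
    -- `Q̄(z)` is a deterministic equivalent of `Q(z)`
    SumSeparable.IsDeterministicEquivalent μ
      (fun n ω => SumSeparable.resolvent (A n) (B n) (fun r => Z n r ω) z)
      (fun n => SumSeparable.Qbar μ (A n) (B n) (Z n) z) := by
  exact theorem4p6_general (Asymptotics.isTheta_of_div_tendsto_nhds_ne_zero hpn hc.ne').symm
    hA hB hAτ hBτ hBdiag hZmeas hZindep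
    (fun n r i j => .of_bound (hZmeas n r i j).aestronglyMeasurable _ (hZbdd n r i j)) hZmean hZvar
    (SumSeparable.isLittleO_rpow_sq_natCast (by linarith))
    (fun n r i j => SumSeparable.integral_norm_pow_four_le_sq (hZbdd n r i j) (hZvar n r i j)) hz
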